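/- **Setting.** Let $U\subseteq\mathbb C$ be open and connected, let $f$ be a nonconstant meromorphic function on $U$, and let $z_0\in U$ be a simple zero of $f$ (so $f(z_0)=0\neq f'(z_0)$). Write $\phi=\frac{1+\sqrt5}{2}$. The secant map is the partially defined map $$S_f(x,y)=\left(\frac{f(x)y-f(y)x}{f(x)-f(y)},\,x\right),\qquad (x,y)\in U\times U,$$ with its first coordinate extended holomorphically wherever possible: on the diagonal it is $x-f(x)/f'(x)$ when $x$ is not a pole and $f'(x)\ne0$; if exactly one of $x,y$ is a pole, it is the other one of the two points; at $(x,x)$ with $x$ a simple pole, it is $x$. Points where the first coordinate is infinite or indeterminate do not belong to its domain. Let $$\mathcal A=\mathcal A(f,z_0)=\Big\{(x,y)\in U\times U:\ S_f^{\circ n}(x,y)\text{ is defined and lies in }U\times U\text{ for all }n,\ \lim_{n\to\infty}S_f^{\circ n}(x,y)=(z_0,z_0)\Big\}$$ be the basin of attraction of $(z_0,z_0)$. **Corollary 3.2 (Potential Function).** Assume $f''(z_0)\neq0$. Then there is a unique continuous function $\widehat{\mathcal H}:\mathcal A\to\mathbb R$ (the Böttcher-type modulus about $(z_0,z_0)$)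 such that, with $\pi_1(x,y)=x$, $$\lim_{n\to\infty}\left|\pi_1(S_f^{\circ n}(x,y))-z_0\right|^{1/\phi^n}=\widehat{\mathcal H}(x,y)\,|x-z_0|^{\phi/\sqrt5}\,|y-z_0|^{1/\sqrt5}\qquad\text{for all }(x,y)\in\mathcal A,$$ the existence of the limit being part of the claim. Define $h:\mathcal A\to\mathbb R$ by $$h(x,y)=\max\left\{\widehat{\mathcal H}(x,y)\,|x-z_0|^{\phi/\sqrt5}|y-z_0|^{1/\sqrt5},\ \ \widehat{\mathcal H}(x,y)^{1/\phi}\,|x-z_0|^{1/\sqrt5}|y-z_0|^{\phi^{-1}/\sqrt5}\right\}.$$ 1. $h$ is continuous on $\mathcal A$, and $h(S_f(x,y))=h(x,y)^{\phi}$ for all $(x,y)\in\mathcal A$. 2. For every norm $\|\cdot\|$ on $\mathbb C^2$ and all $(x,y)\in\mathcal A$, the limit $\lim_{n\to\infty}\|S_f^{\circ n}(x,y)-(z_0,z_0)\|^{1/\phi^n}$ exists and equals $h(x,y)$; in particular it does not depend on the norm. 3. The zero set of $h$ is exactly the set of iterated preimages of $(z_0,z_0)$: $h^{-1}(\{0\})=\bigcup_{n\ge0}S_f^{\circ(-n)}(\{(z_0,z_0)\})$.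 4. For all $(x,y)\in\mathcal A$ we have $0\le h(x,y)<1$ and $$h(x,y)=\widehat{\mathcal H}(x,y)^{1/\phi}\,|x-z_0|^{1/\sqrt5}\,|y-z_0|^{\phi^{-1}/\sqrt5}.$$ -/

import Mathlib

open Filter Topology

namespace SecantMethod

/-- The point `x` is a pole of the meromorphic function `f`. -/
def IsPole (f : ℂ → ℂ) (x : ℂ) : Prop := meromorphicOrderAt f x < 0

open Classical in
/-- The first coordinate of the secant map, extended holomorphically from the set where
`x ≠ y`, neither `x` nor `y` is a pole, and `f x ≠ f y`.  On the diagonal the extension is Newton's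
map; if exactly one of `x`, `y` is a pole of `f`, the extension takes the value of the
other one; at `(x, x)` with `x` a simple pole it takes the value `x`.
The value is meaningful only on `secantDomain`. -/
noncomputable def secantFirst (f : ℂ → ℂ) (x y : ℂ) : ℂ :=
  if IsPole f x then y
  else if IsPole f y then x
  else if x = y then x - f x / deriv f x
  else (f x * y - f y * x) / (f x - f y)

/-- The secant map `S_f (x, y) = ((f x * y - f y * x) / (f x - f y), x)`, extended as in
`secantFirst`; to be used on `secantDomain` only. -/
noncomputable def secantMap (f : ℂ → ℂ) (p : ℂ × ℂ) : ℂ × ℂ :=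
  (secantFirst f p.1 p.2, p.1)

/-- The points of `U × U` at which the secant map of `f` is defined with finite value.
The points of `U × U` left out are
* the points where the value is `∞` (`x ≠ y` and `f x = f y ≠ 0`, or `x = y` and
  `f' x = 0 ≠ f x`), and
* the points of indeterminacy (two distinct zeros, two distinct poles, or `x = y` a multiple
  zero or a multiple pole). -/
def secantDomain (f : ℂ → ℂ) (U : Set ℂ) : Set (ℂ × ℂ) :=
  {p | p.1 ∈ U ∧ p.2 ∈ U ∧
    ((¬ IsPole f p.1 ∧ ¬ IsPole f p.2 ∧ p.1 ≠ p.2 ∧ f p.1 ≠ f p.2) ∨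
     (¬ IsPole f p.1 ∧ p.1 = p.2 ∧ deriv f p.1 ≠ 0) ∨
     (IsPole f p.1 ∧ ¬ IsPole f p.2) ∨
     (¬ IsPole f p.1 ∧ IsPole f p.2) ∨
     (p.1 = p.2 ∧ meromorphicOrderAt f p.1 = -1))}

/-- The basin of attraction of `(z₀, z₀)`: all iterates of the secant map are defined
(and lie in `U × U`), and they converge to `(z₀, z₀)`. -/
def basin (f : ℂ → ℂ) (U : Set ℂ) (z₀ : ℂ) : Set (ℂ × ℂ) :=
  {p | (∀ n : ℕ, (secantMap f)^[n] p ∈ secantDomain f U) ∧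
    Tendsto (fun n : ℕ => (secantMap f)^[n] p) atTop (𝓝 (z₀, z₀))}

theorem secantMap_mem_basin {f : ℂ → ℂ} {U : Set ℂ} {z₀ : ℂ} {p : ℂ × ℂ}
    (hp : p ∈ basin f U z₀) : secantMap f p ∈ basin f U z₀ := by
  refine ⟨fun n => ?_, ?_⟩
  · have h := hp.1 (n + 1)
    rwa [Function.iterate_succ_apply] at h
  · have h := hp.2.comp (tendsto_add_atTop_nat 1)
    simpa only [Function.comp_def, Function.iterate_succ_apply] using h

/-- The secant map as a self-map of the basin. -/
noncomputable def basinMap (f : ℂ → ℂ) (U : Set ℂ) (z₀ : ℂ) (p : basin f U z₀) :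
    basin f U z₀ :=
  ⟨secantMap f p, secantMap_mem_basin p.2⟩

/-- The iterated preimages of `(z₀, z₀)` under the partially defined secant map. -/
def iteratedPreimages (f : ℂ → ℂ) (U : Set ℂ) (z₀ : ℂ) : Set (ℂ × ℂ) :=
  ⋃ n : ℕ, {p | (∀ k < n, (secantMap f)^[k] p ∈ secantDomain f U) ∧
    (secantMap f)^[n] p = (z₀, z₀)}

/-- `H` is the Böttcher-type modulus about `(z₀, z₀)`: the continuous real function on the
basin such that `lim |π₁ (S_f^n (x, y)) - z₀| ^ (1/φ^n)` exists and equals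
`H (x, y) * |x - z₀| ^ (φ/√5) * |y - z₀| ^ (1/√5)` at all points of the basin. -/
def IsBottcherModulus (f : ℂ → ℂ) (U : Set ℂ) (z₀ : ℂ) (H : basin f U z₀ → ℝ) : Prop :=
  Continuous H ∧
    ∀ p : basin f U z₀,
      Tendsto
        (fun n : ℕ => ‖((secantMap f)^[n] p.1).1 - z₀‖ ^ (1 / Real.goldenRatio ^ n : ℝ)) atTop
        (𝓝 (H p * ‖p.1.1 - z₀‖ ^ (Real.goldenRatio / √5 : ℝ) * ‖p.1.2 - z₀‖ ^ (1 / √5 : ℝ)))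

/-- The function `h` built from the Böttcher-type modulus `H`. -/
noncomputable def potential (f : ℂ → ℂ) (U : Set ℂ) (z₀ : ℂ) (H : basin f U z₀ → ℝ)
    (p : basin f U z₀) : ℝ :=
  max (H p * ‖p.1.1 - z₀‖ ^ (Real.goldenRatio / √5 : ℝ) * ‖p.1.2 - z₀‖ ^ (1 / √5 : ℝ))
    (H p ^ (1 / Real.goldenRatio : ℝ) * ‖p.1.1 - z₀‖ ^ (1 / √5 : ℝ) *
      ‖p.1.2 - z₀‖ ^ (Real.goldenRatio⁻¹ / √5 : ℝ))

end SecantMethod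

namespace SecantMethod

/-! With q(x) = f(x)/(x - z₀), the first coordinate of the secant map satisfies S₁(x, y) - z₀ = (x -
z₀)(y - z₀) g(x, y), where g is the quotient of the divided differences of q and f
(`secantFirst_sub_root`). The factor g extends continuously to the whole domain, poles included
(`secantDomain_mem_nhds_and_continuousAt`), and g(z₀, z₀) = f''(z₀)/(2f'(z₀)) ≠ 0.

Hence the errors obey eₙ₊₂ = eₙ₊₁ eₙ gₙ, with gₙ the value of g at the n-th iterate. If none
vanishes, log|eₙ| solves a Fibonacci recursion with bounded perturbation log|gₙ|, and
`tendsto_div_goldenRatio_pow` gives its growth rate. Exponentiating, the modulus is the product of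
|gₖ| ^ (φ⁻ᵏ/√5). If some error or factor vanishes, the orbit lands on (z₀, z₀) and both sides are 0.
Near (z₀, z₀) there is an invariant ball where log|g| is bounded (`exists_isTrap`); every basin
orbit enters it, so the basin is open and the product converges locally uniformly up to finitely
many factors. Uniqueness follows because the limit determines the modulus off the axes, a dense set.

Let L be the limit of |π₁(Sⁿ) - z₀| ^ (1/φⁿ). Shifting n gives L ∘ S = L ^ φ; continuity and L(z₀,
z₀) = 0 then force L < 1, so the maximum defining the potential is L ^ (1/φ). The second entry of
the maximum comes from the second coordinate, which lags one step behind. -/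

/-! ### Poles of functions in normal form -/

theorem not_isPole_of_analyticAt {f : ℂ → ℂ} {x : ℂ} (h : AnalyticAt ℂ f x) : ¬ IsPole f x :=
  not_lt.2 h.meromorphicOrderAt_nonneg

theorem analyticAt_of_not_isPole {f : ℂ → ℂ} {x : ℂ} (hf : MeromorphicNFAt f x)
    (h : ¬ IsPole f x) : AnalyticAt ℂ f x :=
  hf.meromorphicOrderAt_nonneg_iff_analyticAt.1 (not_lt.1 h)

theorem not_isPole_of_continuousAt {f : ℂ → ℂ} {x : ℂ} (hf : MeromorphicNFAt f x)
    (h : ContinuousAt f x) : ¬ IsPole f x :=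
  not_lt.2 ((tendsto_nhds_iff_meromorphicOrderAt_nonneg hf.meromorphicAt).1
    ⟨f x, h.tendsto.mono_left nhdsWithin_le_nhds⟩)

/-- Poles are isolated. -/
theorem eventually_eq_or_analyticAt {f : ℂ → ℂ} {x : ℂ} (hf : MeromorphicNFAt f x) :
    ∀ᶠ u in 𝓝 x, u ≠ x → AnalyticAt ℂ f u :=
  eventually_nhdsWithin_iff.1 hf.meromorphicAt.eventually_analyticAt

/-- Near a pole the reciprocal is analytic and vanishes at the pole only. -/
theorem IsPole.inv {f : ℂ → ℂ} {x : ℂ} (hf : MeromorphicNFAt f x) (h : IsPole f x) :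
    AnalyticAt ℂ f⁻¹ x ∧ f x = 0 ∧ ∀ᶠ u in 𝓝 x, u ≠ x → f u ≠ 0 := by
  have hord : 0 < meromorphicOrderAt f⁻¹ x := by
    rw [meromorphicOrderAt_inv]
    unfold IsPole at h
    cases ho : meromorphicOrderAt f x with
    | top => rw [ho] at h; simp at h
    | coe n =>
      rw [ho] at h
      have : n < 0 := by exact_mod_cast h
      have h2 : (0 : WithTop ℤ) < ((-n : ℤ) : WithTop ℤ) := by exact_mod_cast (by omega : 0 < -n)
      exact h2
  refine ⟨hf.inv.meromorphicOrderAt_nonneg_iff_analyticAt.1 hord.le, ?_, ?_⟩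
  -- In normal form a nonzero value forces order 0, so the value at a pole is the default 0.
  · by_contra h0
    exact absurd (hf.meromorphicOrderAt_eq_zero_iff.2 h0) (ne_of_lt h)
  · exact eventually_nhdsWithin_iff.1
      ((meromorphicOrderAt_ne_top_iff_eventually_ne_zero hf.meromorphicAt).1 (ne_top_of_lt h))

/-- The reciprocal has a simple zero, and differentiating lowers the order of a zero by one, leaving
order 0. -/
theorem deriv_inv_ne_zero_of_simple_pole {f : ℂ → ℂ} {x : ℂ} (hf : MeromorphicNFAt f x)
    (h : meromorphicOrderAt f x = -1) : deriv f⁻¹ x ≠ 0 := by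
  have hp : IsPole f x := by
    unfold IsPole; rw [h]; decide
  obtain ⟨hF, h0, -⟩ := hp.inv hf
  intro hd
  have h1 : meromorphicOrderAt f⁻¹ x = 1 := by
    rw [meromorphicOrderAt_inv, h]; rfl
  have hF0 : f⁻¹ x = 0 := by simp [h0]
  have h2 := hF.analyticOrderAt_deriv_add_one
  rw [hF0] at h2
  simp only [sub_zero] at h2
  have h3 : analyticOrderAt f⁻¹ x = 1 := by
    rw [hF.meromorphicOrderAt_eq] at h1
    cases ho : analyticOrderAt f⁻¹ x with
    | top => rw [ho] at h1; simp at h1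
    | coe n => rw [ho] at h1; simp at h1; simp [h1]
  have h4 : analyticOrderAt (deriv f⁻¹) x ≠ 0 :=
    (hF.deriv.analyticOrderAt_ne_zero).2 hd
  change analyticOrderAt (deriv f⁻¹) x + 1 = analyticOrderAt f⁻¹ x at h2
  rw [h3] at h2
  cases ho : analyticOrderAt (deriv f⁻¹) x with
  | top => rw [ho] at h2; simp at h2
  | coe n =>
    rw [ho] at h2 h4
    have : n + 1 = 1 := by exact_mod_cast h2
    exact h4 (by simp [show n = 0 by omega])

/-! ### Divided differences -/

/-- The divided difference of an analytic function is jointly continuous at the diagonal. -/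
theorem continuousAt_dslope_diag {F : ℂ → ℂ} {x : ℂ} (hF : AnalyticAt ℂ F x) :
    ContinuousAt (fun p : ℂ × ℂ => dslope F p.1 p.2) (x, x) := by
  -- Strict differentiability controls pairs of distinct points near x; continuity of F' handles the
  -- diagonal.
  have hs := hF.hasStrictDerivAt
  have hd := hF.deriv.continuousAt
  rw [Metric.continuousAt_iff'] at hd
  rw [Metric.continuousAt_iff']
  intro ε hε
  have h1 := hs.hasStrictFDerivAt.isLittleO.bound (half_pos hε)
  have h2 : ∀ᶠ p : ℂ × ℂ in 𝓝 (x, x), dist (deriv F p.1) (deriv F x) < ε :=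
    (continuousAt_fst (p := ((x, x) : ℂ × ℂ))).eventually (hd ε hε)
  filter_upwards [h1, h2] with p hp hp2
  rcases eq_or_ne p.1 p.2 with h | h
  · rw [← h]; simpa using hp2
  · have hne : p.2 - p.1 ≠ 0 := sub_ne_zero.2 h.symm
    rw [dslope_of_ne _ h.symm, dslope_same, dist_eq_norm, slope_def_field]
    have hpos : 0 < ‖p.1 - p.2‖ := norm_pos_iff.2 (sub_ne_zero.2 h)
    have : (F p.2 - F p.1) / (p.2 - p.1) - deriv F x =
        (F p.1 - F p.2 - (p.1 - p.2) * deriv F x) / (p.1 - p.2) := by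
      have : p.1 - p.2 ≠ 0 := sub_ne_zero.2 h
      field_simp
      ring
    rw [this, norm_div]
    have h3 : ‖F p.1 - F p.2 - (p.1 - p.2) * deriv F x‖ ≤ ε / 2 * ‖p.1 - p.2‖ := by
      simpa using hp
    calc _ ≤ ε / 2 := by rwa [div_le_iff₀ hpos]
      _ < ε := half_lt_self hε

theorem analyticAt_dslope {f : ℂ → ℂ} {z x : ℂ} (hx : AnalyticAt ℂ f x) :
    AnalyticAt ℂ (dslope f z) x := by
  rcases eq_or_ne x z with rfl | h
  · obtain ⟨s, hs, hd⟩ := hx.eventually_analyticAt.exists_mem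
    have hd' : DifferentiableOn ℂ f s := fun y hy => (hd y hy).differentiableAt.differentiableWithinAt
    exact ((Complex.differentiableOn_dslope hs).2 hd').analyticAt hs
  · have : AnalyticAt ℂ (fun y => (f y - f z) / (y - z)) x :=
      (hx.sub analyticAt_const).div (analyticAt_id.sub analyticAt_const) (sub_ne_zero.2 h)
    refine this.congr ?_
    filter_upwards [isOpen_ne.mem_nhds h] with y hy
    rw [dslope_of_ne _ hy, slope_def_field]

/-! ### Factorization of the secant map at the root -/

open Classical in
/-- The function `g` in the factorization `S₁ (x, y) - z₀ = (x - z₀) * (y - z₀) * g (x, y)` of the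
first coordinate of the secant map. -/
noncomputable def secantFactor (f : ℂ → ℂ) (z₀ : ℂ) (p : ℂ × ℂ) : ℂ :=
  if IsPole f p.1 then (p.1 - z₀)⁻¹
  else if IsPole f p.2 then (p.2 - z₀)⁻¹
  else if p.1 = p.2 then deriv (dslope f z₀) p.1 / deriv f p.1
  else (dslope f z₀ p.1 - dslope f z₀ p.2) / (f p.1 - f p.2)

theorem eq_sub_mul_dslope {f : ℂ → ℂ} {z₀ : ℂ} (hroot : f z₀ = 0) (x : ℂ) :
    f x = (x - z₀) * dslope f z₀ x := by
  have := sub_smul_dslope f z₀ x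
  simpa [hroot] using this.symm

theorem deriv_eq_of_root {f : ℂ → ℂ} {z₀ x : ℂ} (hroot : f z₀ = 0) (hx : AnalyticAt ℂ f x) :
    deriv f x = dslope f z₀ x + (x - z₀) * deriv (dslope f z₀) x := by
  have h1 : HasDerivAt (fun y => (y - z₀) * dslope f z₀ y)
      (1 * dslope f z₀ x + (x - z₀) * deriv (dslope f z₀) x) x :=
    ((hasDerivAt_id x).sub_const z₀).mul (analyticAt_dslope hx).differentiableAt.hasDerivAt
  have h2 : f = fun y => (y - z₀) * dslope f z₀ y := funext (eq_sub_mul_dslope hroot)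
  rw [← h2, one_mul] at h1
  exact h1.deriv

/-- Differentiating f = (x - z₀) q twice leaves 2q'(z₀) at the root; this links f''(z₀) to the value
of the factor there. -/
theorem deriv_dslope_root {f : ℂ → ℂ} {z₀ : ℂ} (hroot : f z₀ = 0) (hz : AnalyticAt ℂ f z₀) :
    deriv (deriv f) z₀ = 2 * deriv (dslope f z₀) z₀ := by
  have hq := analyticAt_dslope (z := z₀) hz
  have h1 : deriv f =ᶠ[𝓝 z₀] fun x => dslope f z₀ x + (x - z₀) * deriv (dslope f z₀) x := by
    filter_upwards [hz.eventually_analyticAt] with x hx using deriv_eq_of_root hroot hx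
  rw [h1.deriv_eq]
  have h2 : HasDerivAt (fun x => dslope f z₀ x + (x - z₀) * deriv (dslope f z₀) x)
      (deriv (dslope f z₀) z₀ + (1 * deriv (dslope f z₀) z₀ +
        (z₀ - z₀) * deriv (deriv (dslope f z₀)) z₀)) z₀ :=
    hq.differentiableAt.hasDerivAt.add
      (((hasDerivAt_id z₀).sub_const z₀).mul hq.deriv.differentiableAt.hasDerivAt)
  rw [h2.deriv]
  ring

variable {f : ℂ → ℂ} {U : Set ℂ} {z₀ : ℂ}

/-- Off the diagonal and the poles, the numerator of S₁ - z₀ is f(x)(y - z₀) - f(y)(x - z₀);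
substituting f = (x - z₀) q pulls out both errors. On the diagonal the same is done with f' = q + (x
- z₀) q'. -/
theorem secantFirst_sub_root (hf : MeromorphicNFOn f U) (hroot : f z₀ = 0)
    (hz : AnalyticAt ℂ f z₀) {p : ℂ × ℂ} (hp : p ∈ secantDomain f U) :
    secantFirst f p.1 p.2 - z₀ = (p.1 - z₀) * (p.2 - z₀) * secantFactor f z₀ p := by
  obtain ⟨x, y⟩ := p
  obtain ⟨hx, hy, h⟩ := hp
  have hzp := not_isPole_of_analyticAt hz
  unfold secantFirst secantFactor
  dsimp only at *
  have hne : ∀ w, IsPole f w → w - z₀ ≠ 0 := fun w hw h0 => hzp (by rwa [← sub_eq_zero.1 h0])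
  by_cases hpx : IsPole f x
  · have := hne x hpx
    simp only [hpx, if_true]
    field_simp
  by_cases hpy : IsPole f y
  · have := hne y hpy
    simp only [hpx, hpy, if_true, if_false]
    field_simp
  simp only [hpx, hpy, if_false]
  have hax := analyticAt_of_not_isPole (hf hx) hpx
  split_ifs with hxy
  · subst hxy
    have hd : deriv f x ≠ 0 := by
      rcases h with h | h | h | h | h
      · exact absurd rfl h.2.2.1
      · exact h.2.2
      · exact absurd h.1 hpx
      · exact absurd h.2 hpx
      · refine absurd ?_ hpx
        unfold IsPole; rw [h.2]; decide
    have h1 := eq_sub_mul_dslope hroot x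
    have h2 := deriv_eq_of_root hroot hax
    field_simp
    linear_combination (x - z₀) * h2 - h1
  · have hd : f x - f y ≠ 0 := by
      rcases h with h | h | h | h | h
      · exact sub_ne_zero.2 h.2.2.2
      · exact absurd h.2.1 hxy
      · exact absurd h.1 hpx
      · exact absurd h.2 hpy
      · exact absurd h.1 hxy
    have h1 := eq_sub_mul_dslope hroot x
    have h2 := eq_sub_mul_dslope hroot y
    field_simp
    linear_combination (y - z₀) * h1 - (x - z₀) * h2

/-! ### Openness of the domain and continuity of the factor -/

theorem mem_nhds_and_continuousAt_of_ne (hU : IsOpen U) (hf : MeromorphicNFOn f U)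
    {x y : ℂ} (hxU : x ∈ U) (hyU : y ∈ U) (hx : ¬ IsPole f x) (hy : ¬ IsPole f y)
    (hxy : x ≠ y) (hfxy : f x ≠ f y) :
    secantDomain f U ∈ 𝓝 (x, y) ∧ ContinuousAt (secantFactor f z₀) (x, y) := by
  have hax := analyticAt_of_not_isPole (hf hxU) hx
  have hay := analyticAt_of_not_isPole (hf hyU) hy
  have h1 : ∀ᶠ p : ℂ × ℂ in 𝓝 (x, y), AnalyticAt ℂ f p.1 ∧ p.1 ∈ U :=
    (continuousAt_fst (p := (x, y))).eventually
      (hax.eventually_analyticAt.and (hU.mem_nhds hxU))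
  have h2 : ∀ᶠ p : ℂ × ℂ in 𝓝 (x, y), AnalyticAt ℂ f p.2 ∧ p.2 ∈ U :=
    (continuousAt_snd (p := (x, y))).eventually
      (hay.eventually_analyticAt.and (hU.mem_nhds hyU))
  have c1 : ∀ {F : ℂ → ℂ}, AnalyticAt ℂ F x → ContinuousAt (fun p : ℂ × ℂ => F p.1) (x, y) :=
    fun hF => ContinuousAt.comp' (g := _) (f := Prod.fst) hF.continuousAt continuousAt_fst
  have c2 : ∀ {F : ℂ → ℂ}, AnalyticAt ℂ F y → ContinuousAt (fun p : ℂ × ℂ => F p.2) (x, y) :=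
    fun hF => ContinuousAt.comp' (g := _) (f := Prod.snd) hF.continuousAt continuousAt_snd
  have h3 : ∀ᶠ p : ℂ × ℂ in 𝓝 (x, y), p.1 ≠ p.2 := by
    have : IsOpen {p : ℂ × ℂ | p.1 ≠ p.2} := isOpen_ne_fun continuous_fst continuous_snd
    exact this.mem_nhds hxy
  have h4 : ∀ᶠ p : ℂ × ℂ in 𝓝 (x, y), f p.1 - f p.2 ≠ 0 :=
    ((c1 hax).sub (c2 hay)).eventually_ne (sub_ne_zero.2 hfxy)
  constructor
  · filter_upwards [h1, h2, h3, h4] with p h1 h2 h3 h4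
    exact ⟨h1.2, h2.2, Or.inl ⟨not_isPole_of_analyticAt h1.1, not_isPole_of_analyticAt h2.1, h3,
      sub_ne_zero.1 h4⟩⟩
  · have : ContinuousAt (fun p : ℂ × ℂ =>
        (dslope f z₀ p.1 - dslope f z₀ p.2) / (f p.1 - f p.2)) (x, y) :=
      ((c1 (analyticAt_dslope hax)).sub (c2 (analyticAt_dslope hay))).div
        ((c1 hax).sub (c2 hay)) (sub_ne_zero.2 hfxy)
    refine this.congr ?_
    filter_upwards [h1, h2, h3] with p h1 h2 h3
    simp only [secantFactor, not_isPole_of_analyticAt h1.1, not_isPole_of_analyticAt h2.1, h3,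
      if_false]

/-- Both cases of the factor near (x, x) are the single quotient q[u, v]/f[u, v] of divided
differences, which are jointly continuous at (x, x). -/
theorem mem_nhds_and_continuousAt_diag (hU : IsOpen U) (hf : MeromorphicNFOn f U)
    {x : ℂ} (hxU : x ∈ U) (hx : ¬ IsPole f x) (hd : deriv f x ≠ 0) :
    secantDomain f U ∈ 𝓝 (x, x) ∧ ContinuousAt (secantFactor f z₀) (x, x) := by
  have hax := analyticAt_of_not_isPole (hf hxU) hx
  have h0 := hax.eventually_analyticAt.and (hU.mem_nhds hxU)
  have h1 : ∀ᶠ p : ℂ × ℂ in 𝓝 (x, x), AnalyticAt ℂ f p.1 ∧ p.1 ∈ U :=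
    (continuousAt_fst (p := (x, x))).eventually h0
  have h2 : ∀ᶠ p : ℂ × ℂ in 𝓝 (x, x), AnalyticAt ℂ f p.2 ∧ p.2 ∈ U :=
    (continuousAt_snd (p := (x, x))).eventually h0
  have cf := continuousAt_dslope_diag hax
  have cq := continuousAt_dslope_diag (analyticAt_dslope (z := z₀) hax)
  have hd' : dslope f x x ≠ 0 := by rwa [dslope_same]
  have h3 : ∀ᶠ p : ℂ × ℂ in 𝓝 (x, x), dslope f p.1 p.2 ≠ 0 := cf.eventually_ne hd'
  constructor
  · filter_upwards [h1, h2, h3] with p h1 h2 h3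
    refine ⟨h1.2, h2.2, ?_⟩
    have n1 := not_isPole_of_analyticAt h1.1
    have n2 := not_isPole_of_analyticAt h2.1
    rcases eq_or_ne p.1 p.2 with h | h
    · rw [← h, dslope_same] at h3
      exact Or.inr (Or.inl ⟨n1, h, h3⟩)
    · refine Or.inl ⟨n1, n2, h, fun h4 => h3 ?_⟩
      rw [dslope_of_ne _ h.symm, slope_def_field, h4]
      simp
  · refine (cq.div cf hd').congr ?_
    filter_upwards [h1, h2] with p h1 h2
    simp only [secantFactor, not_isPole_of_analyticAt h1.1, not_isPole_of_analyticAt h2.1,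
      if_false]
    split_ifs with h
    · simp [← h]
    · have hne : p.2 - p.1 ≠ 0 := sub_ne_zero.2 (Ne.symm h)
      simp only [Pi.div_apply]
      rw [dslope_of_ne _ (Ne.symm h), dslope_of_ne _ (Ne.symm h), slope_def_field, slope_def_field,
        div_div_div_cancel_right₀ hne, ← neg_sub (dslope f z₀ p.1), ← neg_sub (f p.1), neg_div_neg_eq]

/-- Two poles are excluded because the definition then favours the first coordinate. -/
theorem secantFactor_symm (p : ℂ × ℂ) (h : ¬ IsPole f p.1 ∨ ¬ IsPole f p.2) :
    secantFactor f z₀ p = secantFactor f z₀ p.swap := by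
  obtain ⟨x, y⟩ := p
  simp only [secantFactor, Prod.swap]
  dsimp only at h
  by_cases h1 : IsPole f x
  · have h2 : ¬ IsPole f y := by tauto
    simp [h1, h2]
  · by_cases h2 : IsPole f y
    · simp [h1, h2]
    · simp only [h1, h2, if_false]
      by_cases h3 : x = y
      · simp [h3]
      · rw [if_neg h3, if_neg (Ne.symm h3), ← neg_sub (dslope f z₀ x), ← neg_sub (f x),
          neg_div_neg_eq]

theorem secantDomain_swap {p : ℂ × ℂ} (h : p ∈ secantDomain f U) :
    p.swap ∈ secantDomain f U := by
  obtain ⟨x, y⟩ := p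
  obtain ⟨hx, hy, h⟩ := h
  refine ⟨hy, hx, ?_⟩
  dsimp only [Prod.swap] at *
  rcases h with h | h | h | h | h
  · exact Or.inl ⟨h.2.1, h.1, h.2.2.1.symm, h.2.2.2.symm⟩
  · obtain ⟨h1, rfl, h2⟩ := h
    exact Or.inr (Or.inl ⟨h1, rfl, h2⟩)
  · exact Or.inr (Or.inr (Or.inr (Or.inl ⟨h.2, h.1⟩)))
  · exact Or.inr (Or.inr (Or.inl ⟨h.2, h.1⟩))
  · obtain ⟨rfl, h2⟩ := h
    exact Or.inr (Or.inr (Or.inr (Or.inr ⟨rfl, h2⟩)))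

/-- Dividing numerator and denominator by f(x) gives (1/(x - z₀) - q(y)/f(x)) / (1 - f(y)/f(x)),
which involves f near the pole only through the analytic function 1/f. -/
theorem mem_nhds_and_continuousAt_pole_fst (hU : IsOpen U) (hf : MeromorphicNFOn f U)
    (hroot : f z₀ = 0) (hz : AnalyticAt ℂ f z₀)
    {x y : ℂ} (hxU : x ∈ U) (hyU : y ∈ U) (hx : IsPole f x) (hy : ¬ IsPole f y) :
    secantDomain f U ∈ 𝓝 (x, y) ∧ ContinuousAt (secantFactor f z₀) (x, y) := by
  have hay := analyticAt_of_not_isPole (hf hyU) hy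
  obtain ⟨hF, hfx, hne⟩ := hx.inv (hf hxU)
  have hxz : x ≠ z₀ := fun h => not_isPole_of_analyticAt hz (h ▸ hx)
  have hxy : x ≠ y := fun h => hy (h ▸ hx)
  have h1 : ∀ᶠ p : ℂ × ℂ in 𝓝 (x, y), (p.1 ≠ x → AnalyticAt ℂ f p.1) ∧ (p.1 ≠ x → f p.1 ≠ 0) ∧
      p.1 ≠ z₀ ∧ p.1 ∈ U :=
    (continuousAt_fst (p := (x, y))).eventually
      ((eventually_eq_or_analyticAt (hf hxU)).and (hne.and ((isOpen_ne.eventually_mem hxz).and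
        (hU.mem_nhds hxU))))
  have h2 : ∀ᶠ p : ℂ × ℂ in 𝓝 (x, y), AnalyticAt ℂ f p.2 ∧ p.2 ∈ U :=
    (continuousAt_snd (p := (x, y))).eventually
      (hay.eventually_analyticAt.and (hU.mem_nhds hyU))
  have c1 : ∀ {F : ℂ → ℂ}, AnalyticAt ℂ F x → ContinuousAt (fun p : ℂ × ℂ => F p.1) (x, y) :=
    fun hF => ContinuousAt.comp' (g := _) (f := Prod.fst) hF.continuousAt continuousAt_fst
  have c2 : ∀ {F : ℂ → ℂ}, AnalyticAt ℂ F y → ContinuousAt (fun p : ℂ × ℂ => F p.2) (x, y) :=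
    fun hF => ContinuousAt.comp' (g := _) (f := Prod.snd) hF.continuousAt continuousAt_snd
  have h3 : ∀ᶠ p : ℂ × ℂ in 𝓝 (x, y), p.1 ≠ p.2 := by
    have : IsOpen {p : ℂ × ℂ | p.1 ≠ p.2} := isOpen_ne_fun continuous_fst continuous_snd
    exact this.mem_nhds hxy
  -- The conventions f x = 0 at a pole and 0⁻¹ = 0 give 1/f its true value there.
  have hFx : f⁻¹ x = 0 := by simp [hfx]
  have cden : ContinuousAt (fun p : ℂ × ℂ => 1 - f p.2 * f⁻¹ p.1) (x, y) :=
    continuousAt_const.sub ((c2 hay).mul (c1 hF))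
  have hden : (1 : ℂ) - f y * f⁻¹ x ≠ 0 := by rw [hFx]; simp
  have h4 : ∀ᶠ p : ℂ × ℂ in 𝓝 (x, y), 1 - f p.2 * f⁻¹ p.1 ≠ 0 := cden.eventually_ne hden
  constructor
  · filter_upwards [h1, h2, h3, h4] with p h1 h2 h3 h4
    have n2 := not_isPole_of_analyticAt h2.1
    refine ⟨h1.2.2.2, h2.2, ?_⟩
    rcases eq_or_ne p.1 x with h | h
    · exact Or.inr (Or.inr (Or.inl ⟨h ▸ hx, n2⟩))
    · refine Or.inl ⟨not_isPole_of_analyticAt (h1.1 h), n2, h3, fun h5 => h4 ?_⟩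
      rw [← h5, Pi.inv_apply, mul_inv_cancel₀ (h1.2.1 h), sub_self]
  · have cz : ContinuousAt (fun p : ℂ × ℂ => (p.1 - z₀)⁻¹) (x, y) :=
      (continuousAt_fst.sub continuousAt_const).inv₀ (sub_ne_zero.2 hxz)
    refine ((cz.sub ((c2 (analyticAt_dslope (z := z₀) hay)).mul (c1 hF))).div cden hden).congr ?_
    filter_upwards [h1, h2, h3] with p h1 h2 h3
    simp only [Pi.div_apply, Pi.sub_apply, Pi.mul_apply, Pi.inv_apply, secantFactor]
    rcases eq_or_ne p.1 x with h | h
    · simp [h, hx, hfx]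
    · have hz1 : p.1 - z₀ ≠ 0 := sub_ne_zero.2 h1.2.2.1
      have hf1 := h1.2.1 h
      simp only [not_isPole_of_analyticAt h2.1, not_isPole_of_analyticAt (h1.1 h), h3, if_false]
      have hq : dslope f z₀ p.1 = f p.1 / (p.1 - z₀) := by
        rw [eq_div_iff hz1, mul_comm, ← eq_sub_mul_dslope hroot]
      rw [hq, ← mul_div_mul_left _ _ hf1]
      congr 1
      · field_simp
      · field_simp

/-- With F = 1/f and K = (w - z₀)F = 1/q, the factor becomes K[u, v] / (F[u, v] (u - z₀)(v - z₀)).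
The denominator does not vanish at (x, x), since F'(x) ≠ 0 at a simple pole. -/
theorem mem_nhds_and_continuousAt_pole_diag (hU : IsOpen U) (hf : MeromorphicNFOn f U)
    (hroot : f z₀ = 0) (hz : AnalyticAt ℂ f z₀)
    {x : ℂ} (hxU : x ∈ U) (hx : meromorphicOrderAt f x = -1) :
    secantDomain f U ∈ 𝓝 (x, x) ∧ ContinuousAt (secantFactor f z₀) (x, x) := by
  have hpx : IsPole f x := by unfold IsPole; rw [hx]; decide
  obtain ⟨hF, hfx, hne⟩ := hpx.inv (hf hxU)
  have hF' := deriv_inv_ne_zero_of_simple_pole (hf hxU) hx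
  have hxz : x ≠ z₀ := fun h => not_isPole_of_analyticAt hz (h ▸ hpx)
  have h0 := ((eventually_eq_or_analyticAt (hf hxU)).and (hne.and ((isOpen_ne.eventually_mem hxz).and
        (hU.mem_nhds hxU))))
  have h1 : ∀ᶠ p : ℂ × ℂ in 𝓝 (x, x), (p.1 ≠ x → AnalyticAt ℂ f p.1) ∧ (p.1 ≠ x → f p.1 ≠ 0) ∧
      p.1 ≠ z₀ ∧ p.1 ∈ U := (continuousAt_fst (p := (x, x))).eventually h0
  have h2 : ∀ᶠ p : ℂ × ℂ in 𝓝 (x, x), (p.2 ≠ x → AnalyticAt ℂ f p.2) ∧ (p.2 ≠ x → f p.2 ≠ 0) ∧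
      p.2 ≠ z₀ ∧ p.2 ∈ U := (continuousAt_snd (p := (x, x))).eventually h0
  have hFx : f⁻¹ x = 0 := by simp [hfx]
  set K : ℂ → ℂ := fun w => (w - z₀) * f⁻¹ w with hK
  have hKa : AnalyticAt ℂ K x := (analyticAt_id.sub analyticAt_const).mul hF
  have cF := continuousAt_dslope_diag hF
  have cK := continuousAt_dslope_diag hKa
  have hd' : dslope f⁻¹ x x ≠ 0 := by rwa [dslope_same]
  have h3 : ∀ᶠ p : ℂ × ℂ in 𝓝 (x, x), dslope f⁻¹ p.1 p.2 ≠ 0 := cF.eventually_ne hd'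
  constructor
  · filter_upwards [h1, h2, h3] with p h1 h2 h3
    refine ⟨h1.2.2.2, h2.2.2.2, ?_⟩
    rcases eq_or_ne p.1 p.2 with h | h
    · rcases eq_or_ne p.1 x with h4 | h4
      · exact Or.inr (Or.inr (Or.inr (Or.inr ⟨h, h4 ▸ hx⟩)))
      · refine Or.inr (Or.inl ⟨not_isPole_of_analyticAt (h1.1 h4), h, fun h5 => h3 ?_⟩)
        rw [← h, dslope_same, deriv_inv'' (h1.1 h4).differentiableAt (h1.2.1 h4), h5]
        simp
    · rcases eq_or_ne p.1 x with h4 | h4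
      · have h6 : p.2 ≠ x := fun h6 => h (h4.trans h6.symm)
        exact Or.inr (Or.inr (Or.inl ⟨h4 ▸ hpx, not_isPole_of_analyticAt (h2.1 h6)⟩))
      · rcases eq_or_ne p.2 x with h6 | h6
        · exact Or.inr (Or.inr (Or.inr (Or.inl ⟨not_isPole_of_analyticAt (h1.1 h4), h6 ▸ hpx⟩)))
        · refine Or.inl ⟨not_isPole_of_analyticAt (h1.1 h4), not_isPole_of_analyticAt (h2.1 h6), h,
            fun h7 => h3 ?_⟩
          rw [dslope_of_ne _ h.symm, slope_def_field, Pi.inv_apply, Pi.inv_apply, h7]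
          simp
  · have cz : ContinuousAt (fun p : ℂ × ℂ => (p.1 - z₀) * (p.2 - z₀)) (x, x) := by fun_prop
    have hxz' : x - z₀ ≠ 0 := sub_ne_zero.2 hxz
    refine (cK.div (cF.mul cz) (mul_ne_zero hd' (mul_ne_zero hxz' hxz'))).congr ?_
    filter_upwards [h1, h2, h3] with p h1 h2 h3
    obtain ⟨u, v⟩ := p
    simp only [Pi.div_apply, Pi.mul_apply] at *
    have hu : u - z₀ ≠ 0 := sub_ne_zero.2 h1.2.2.1
    have hv : v - z₀ ≠ 0 := sub_ne_zero.2 h2.2.2.1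
    have hqu : dslope f z₀ u = f u / (u - z₀) := by
      rw [eq_div_iff hu, mul_comm, ← eq_sub_mul_dslope hroot]
    have hqv : dslope f z₀ v = f v / (v - z₀) := by
      rw [eq_div_iff hv, mul_comm, ← eq_sub_mul_dslope hroot]
    simp only [secantFactor]
    rcases eq_or_ne u v with h | h
    · subst h
      rw [dslope_same, dslope_same] at *
      rcases eq_or_ne u x with h4 | h4
      · subst h4
        have hKd : HasDerivAt K (1 * f⁻¹ u + (u - z₀) * deriv f⁻¹ u) u :=
          ((hasDerivAt_id u).sub_const z₀).mul hF.differentiableAt.hasDerivAt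
        rw [if_pos hpx, hKd.deriv, hFx]
        field_simp
        ring
      · have hau := h1.1 h4
        have hfu := h1.2.1 h4
        have hFd : HasDerivAt f⁻¹ (-deriv f u / f u ^ 2) u :=
          hau.differentiableAt.hasDerivAt.inv hfu
        have hKd : HasDerivAt K (1 * f⁻¹ u + (u - z₀) * (-deriv f u / f u ^ 2)) u :=
          ((hasDerivAt_id u).sub_const z₀).mul hFd
        have h5 := deriv_eq_of_root hroot hau
        rw [hqu] at h5
        rw [hFd.deriv] at h3
        have hdf : deriv f u ≠ 0 := fun h6 => h3 (by rw [h6]; simp)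
        rw [if_neg (not_isPole_of_analyticAt hau), if_neg (not_isPole_of_analyticAt hau), if_pos rfl,
          hKd.deriv, hFd.deriv, Pi.inv_apply]
        have h7 : deriv (dslope f z₀) u = (deriv f u - f u / (u - z₀)) / (u - z₀) := by
          rw [eq_div_iff hu, h5]; ring
        rw [h7]
        field_simp
        ring
    · have hvu : v - u ≠ 0 := sub_ne_zero.2 h.symm
      have hs : ∀ F : ℂ → ℂ, dslope F u v = (F v - F u) / (v - u) := fun F => by
        rw [dslope_of_ne _ h.symm, slope_def_field]
      rw [hs f⁻¹] at h3 ⊢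
      rw [hs K]
      rcases eq_or_ne u x with h4 | h4
      · subst h4
        rw [if_pos hpx]
        have h6 : v ≠ u := h.symm
        have hfv := h2.2.1 h6
        simp only [hK, Pi.inv_apply, hfx, inv_zero, mul_zero, sub_zero]
        field_simp
      · have hfu := h1.2.1 h4
        rw [if_neg (not_isPole_of_analyticAt (h1.1 h4))]
        rcases eq_or_ne v x with h6 | h6
        · subst h6
          rw [if_pos hpx]
          simp only [hK, Pi.inv_apply, hfx, inv_zero, mul_zero, zero_sub]
          field_simp
        · have hfv := h2.2.1 h6
          have hfuv : f u - f v ≠ 0 := fun h7 => h3 (by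
            rw [Pi.inv_apply, Pi.inv_apply, sub_eq_zero.1 h7]; simp)
          rw [if_neg (not_isPole_of_analyticAt (h2.1 h6)), if_neg h, hqu, hqv]
          simp only [hK, Pi.inv_apply]
          rw [inv_sub_inv hfv hfu]
          field_simp

theorem secantDomain_mem_nhds_and_continuousAt (hU : IsOpen U) (hf : MeromorphicNFOn f U)
    (hroot : f z₀ = 0) (hz : AnalyticAt ℂ f z₀) {p : ℂ × ℂ} (hp : p ∈ secantDomain f U) :
    secantDomain f U ∈ 𝓝 p ∧ ContinuousAt (secantFactor f z₀) p := by
  obtain ⟨x, y⟩ := p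
  obtain ⟨hxU, hyU, h⟩ := hp
  dsimp only at *
  rcases h with h | h | h | h | h
  · exact mem_nhds_and_continuousAt_of_ne hU hf hxU hyU h.1 h.2.1 h.2.2.1 h.2.2.2
  · obtain ⟨h1, rfl, h2⟩ := h
    exact mem_nhds_and_continuousAt_diag hU hf hxU h1 h2
  · exact mem_nhds_and_continuousAt_pole_fst hU hf hroot hz hxU hyU h.1 h.2
  · obtain ⟨h1, h2⟩ := mem_nhds_and_continuousAt_pole_fst hU hf hroot hz hyU hxU h.2 h.1
    have hsw : Tendsto (Prod.swap : ℂ × ℂ → ℂ × ℂ) (𝓝 (x, y)) (𝓝 (y, x)) :=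
      continuous_swap.tendsto' _ _ rfl
    refine ⟨?_, ?_⟩
    · filter_upwards [hsw h1] with p hp using by simpa using secantDomain_swap hp
    · have hc : ContinuousAt (secantFactor f z₀ ∘ Prod.swap) (x, y) :=
        ContinuousAt.comp (x := (x, y)) h2 continuous_swap.continuousAt
      refine hc.congr ?_
      have hax := analyticAt_of_not_isPole (hf hxU) h.1
      filter_upwards [(continuousAt_fst (p := (x, y))).eventually hax.eventually_analyticAt]
        with p hp
      exact (secantFactor_symm p (Or.inl (not_isPole_of_analyticAt hp))).symm
  · obtain ⟨rfl, h2⟩ := h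
    exact mem_nhds_and_continuousAt_pole_diag hU hf hroot hz hxU h2

theorem isOpen_secantDomain (hU : IsOpen U) (hf : MeromorphicNFOn f U)
    (hroot : f z₀ = 0) (hz : AnalyticAt ℂ f z₀) : IsOpen (secantDomain f U) :=
  isOpen_iff_mem_nhds.2 fun _ hp => (secantDomain_mem_nhds_and_continuousAt hU hf hroot hz hp).1

theorem continuousOn_secantFactor (hU : IsOpen U) (hf : MeromorphicNFOn f U)
    (hroot : f z₀ = 0) (hz : AnalyticAt ℂ f z₀) :
    ContinuousOn (secantFactor f z₀) (secantDomain f U) := fun _ hp =>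
  (secantDomain_mem_nhds_and_continuousAt hU hf hroot hz hp).2.continuousWithinAt

theorem continuousOn_secantMap (hU : IsOpen U) (hf : MeromorphicNFOn f U)
    (hroot : f z₀ = 0) (hz : AnalyticAt ℂ f z₀) :
    ContinuousOn (secantMap f) (secantDomain f U) := by
  have h := continuousOn_secantFactor hU hf hroot hz
  have h1 : ContinuousOn (fun p : ℂ × ℂ => z₀ + (p.1 - z₀) * (p.2 - z₀) * secantFactor f z₀ p)
      (secantDomain f U) := by fun_prop
  have h2 : ContinuousOn (fun p : ℂ × ℂ => secantFirst f p.1 p.2) (secantDomain f U) :=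
    h1.congr fun p hp => by
      linear_combination secantFirst_sub_root hf hroot hz hp
  exact h2.prodMk continuousOn_fst

/-! ### Perturbed Fibonacci recursions -/

theorem sqrt_five_eq : √5 = 2 * Real.goldenRatio - 1 := by
  unfold Real.goldenRatio; ring

/-- The difference l (n+1) - φ l n is multiplied by 1 - φ, of modulus less than 1, up to an error at
most C. The constant φ² = 1/(2 - φ) is the sum of the geometric series of ratio φ - 1. -/
theorem abs_golden_sub_le {l c : ℕ → ℝ} {C : ℝ} (hc : ∀ n, |c n| ≤ C)
    (hl : ∀ n, l (n + 2) = l (n + 1) + l n + c n) (n : ℕ) :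
    |l (n + 1) - Real.goldenRatio * l n| ≤
      |l 1 - Real.goldenRatio * l 0| + C * Real.goldenRatio ^ 2 := by
  have hsq := Real.goldenRatio_sq
  have h1 := Real.one_lt_goldenRatio
  have h2 := Real.goldenRatio_lt_two
  have hC : 0 ≤ C := (abs_nonneg _).trans (hc 0)
  set K := |l 1 - Real.goldenRatio * l 0| + C * Real.goldenRatio ^ 2 with hK
  have hKC : C ≤ (2 - Real.goldenRatio) * K := by
    have h3 : (2 - Real.goldenRatio) * (C * Real.goldenRatio ^ 2) = C := by
      rw [hsq]; linear_combination (-C) * hsq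
    rw [hK, mul_add, h3]
    have : 0 ≤ (2 - Real.goldenRatio) * |l 1 - Real.goldenRatio * l 0| :=
      mul_nonneg (by linarith) (abs_nonneg _)
    linarith
  induction n with
  | zero => rw [hK]; simpa using by positivity
  | succ n ih =>
    have h4 : l (n + 1 + 1) - Real.goldenRatio * l (n + 1) =
        (1 - Real.goldenRatio) * (l (n + 1) - Real.goldenRatio * l n) + c n := by
      rw [hl n]; linear_combination (-l n) * hsq
    rw [h4]
    calc _ ≤ |1 - Real.goldenRatio| * |l (n + 1) - Real.goldenRatio * l n| + |c n| := by
          rw [← abs_mul]; exact abs_add_le _ _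
      _ ≤ (Real.goldenRatio - 1) * K + C := by
          rw [abs_sub_comm, abs_of_pos (by linarith)]
          have := hc n
          gcongr
      _ ≤ K := by linarith

/-- The weights `φ ^ (-k) / √5` of the Böttcher-type product. -/
noncomputable def goldenWeight (k : ℕ) : ℝ := (Real.goldenRatio ^ k)⁻¹ / √5

theorem goldenWeight_pos (k : ℕ) : 0 < goldenWeight k := by
  have := Real.goldenRatio_pos
  unfold goldenWeight; positivity

theorem summable_goldenWeight : Summable goldenWeight := by
  unfold goldenWeight
  simp_rw [← inv_pow]
  exact (summable_geometric_of_lt_one (inv_nonneg.2 Real.goldenRatio_pos.le)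
    (inv_lt_one_of_one_lt₀ Real.one_lt_goldenRatio)).div_const _

theorem summable_goldenWeight_mul {c : ℕ → ℝ} {C : ℝ} (hc : ∀ n, |c n| ≤ C) :
    Summable fun k => goldenWeight k * c k := by
  refine Summable.of_norm_bounded (summable_goldenWeight.mul_right C) fun k => ?_
  rw [norm_mul, Real.norm_eq_abs, Real.norm_eq_abs, abs_of_pos (goldenWeight_pos k)]
  exact mul_le_mul_of_nonneg_left (hc k) (goldenWeight_pos k).le

/-- Growth of the solutions of a perturbed Fibonacci recursion. -/
theorem tendsto_div_goldenRatio_pow {l c : ℕ → ℝ} {C : ℝ} (hc : ∀ n, |c n| ≤ C)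
    (hl : ∀ n, l (n + 2) = l (n + 1) + l n + c n) :
    Tendsto (fun n => l (n + 1) / Real.goldenRatio ^ n) atTop
      (𝓝 (Real.goldenRatio / √5 * l 1 + 1 / √5 * l 0 + ∑' k, goldenWeight k * c k)) := by
  have hsq := Real.goldenRatio_sq
  have hφ := Real.goldenRatio_pos
  have h5 : (0 : ℝ) < √5 := by positivity
  -- The combination φ l (n+1) + l n is an eigenvector of the recursion for φ, so after division by
  -- φⁿ only the perturbations accumulate.
  have hA : ∀ n, (Real.goldenRatio / √5 * l (n + 1) + 1 / √5 * l n) / Real.goldenRatio ^ n =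
      Real.goldenRatio / √5 * l 1 + 1 / √5 * l 0 +
        ∑ k ∈ Finset.range n, goldenWeight k * c k := by
    intro n
    induction n with
    | zero => simp
    | succ n ih =>
      rw [Finset.sum_range_succ, ← add_assoc, ← ih, hl n, goldenWeight, pow_succ]
      field_simp
      linear_combination (-4 * l (n + 1)) * hsq
  -- Since φ + 1/φ = √5, l (n+1) splits into the two eigencombinations; the second is bounded.
  have hB : ∀ n, l (n + 1) / Real.goldenRatio ^ n =
      (Real.goldenRatio / √5 * l (n + 1) + 1 / √5 * l n) / Real.goldenRatio ^ n +
        (l (n + 1) - Real.goldenRatio * l n) / (Real.goldenRatio * √5) *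
          (Real.goldenRatio⁻¹) ^ n := by
    intro n
    rw [inv_pow]
    field_simp
    rw [sqrt_five_eq]
    linear_combination 4 * l (n + 1) * hsq
  have h0 : Tendsto (fun n => (l (n + 1) - Real.goldenRatio * l n) / (Real.goldenRatio * √5) *
      (Real.goldenRatio⁻¹) ^ n) atTop (𝓝 0) := by
    have hg : Tendsto (fun n : ℕ => (Real.goldenRatio⁻¹) ^ n) atTop (𝓝 0) :=
      tendsto_pow_atTop_nhds_zero_of_lt_one (inv_nonneg.2 hφ.le)
        (inv_lt_one_of_one_lt₀ Real.one_lt_goldenRatio)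
    refine bdd_le_mul_tendsto_zero' ((|l 1 - Real.goldenRatio * l 0| +
      C * Real.goldenRatio ^ 2) / (Real.goldenRatio * √5)) (Eventually.of_forall fun n => ?_) hg
    rw [abs_div, abs_of_pos (mul_pos hφ h5)]
    exact div_le_div_of_nonneg_right (abs_golden_sub_le hc hl n) (by positivity)
  have h1 := (summable_goldenWeight_mul hc).hasSum.tendsto_sum_nat
  have h2 := (h1.const_add (Real.goldenRatio / √5 * l 1 + 1 / √5 * l 0)).add h0
  rw [add_zero] at h2
  exact h2.congr fun n => by rw [hB, hA]

/-! ### Errors and the invariant ball -/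

/-- The errors `y - z₀, x - z₀, x₁ - z₀, …` of the secant iteration started at `(x, y)`. -/
noncomputable def secantError (f : ℂ → ℂ) (z₀ : ℂ) (p : ℂ × ℂ) (n : ℕ) : ℂ :=
  ((secantMap f)^[n] p).2 - z₀

theorem secantError_succ (p : ℂ × ℂ) (n : ℕ) :
    secantError f z₀ p (n + 1) = ((secantMap f)^[n] p).1 - z₀ := by
  rw [secantError, Function.iterate_succ_apply']
  rfl

theorem secantError_add_two (hf : MeromorphicNFOn f U) (hroot : f z₀ = 0)
    (hz : AnalyticAt ℂ f z₀) {p : ℂ × ℂ} {n : ℕ} (hp : (secantMap f)^[n] p ∈ secantDomain f U) :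
    secantError f z₀ p (n + 2) = secantError f z₀ p (n + 1) * secantError f z₀ p n *
      secantFactor f z₀ ((secantMap f)^[n] p) := by
  rw [secantError_succ, secantError_succ, Function.iterate_succ_apply', secantError]
  exact secantFirst_sub_root hf hroot hz hp

/-- The ball of radius `r` about `(z₀, z₀)` is a forward invariant contracted part of the domain,
on which `secantFactor` is bounded and bounded away from `0`. -/
structure IsTrap (f : ℂ → ℂ) (U : Set ℂ) (z₀ : ℂ) (r C : ℝ) : Prop where
  pos : 0 < r
  mem_domain : ∀ p ∈ Metric.ball ((z₀, z₀) : ℂ × ℂ) r, p ∈ secantDomain f U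
  factor_ne_zero : ∀ p ∈ Metric.ball ((z₀, z₀) : ℂ × ℂ) r, secantFactor f z₀ p ≠ 0
  abs_log_le : ∀ p ∈ Metric.ball ((z₀, z₀) : ℂ × ℂ) r, |Real.log ‖secantFactor f z₀ p‖| ≤ C
  contract : ∀ p ∈ Metric.ball ((z₀, z₀) : ℂ × ℂ) r,
    ‖(secantMap f p).1 - z₀‖ ≤ 1 / 2 * ‖p.1 - z₀‖

theorem secantFactor_root (hz : AnalyticAt ℂ f z₀) :
    secantFactor f z₀ (z₀, z₀) = deriv (dslope f z₀) z₀ / deriv f z₀ := by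
  simp [secantFactor, not_isPole_of_analyticAt hz]

theorem secantFactor_root_ne_zero (hroot : f z₀ = 0) (hz : AnalyticAt ℂ f z₀)
    (hsimple : deriv f z₀ ≠ 0) (hf'' : deriv (deriv f) z₀ ≠ 0) :
    secantFactor f z₀ (z₀, z₀) ≠ 0 := by
  rw [secantFactor_root hz]
  rw [deriv_dslope_root hroot hz] at hf''
  exact div_ne_zero (right_ne_zero_of_mul hf'') hsimple

theorem root_mem_secantDomain (hz₀ : z₀ ∈ U) (hz : AnalyticAt ℂ f z₀)
    (hsimple : deriv f z₀ ≠ 0) : (z₀, z₀) ∈ secantDomain f U :=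
  ⟨hz₀, hz₀, Or.inr (Or.inl ⟨not_isPole_of_analyticAt hz, rfl, hsimple⟩)⟩

/-- All conditions are open at (z₀, z₀): the factor is nonzero there because f''(z₀) ≠ 0, and the
contraction ratio ‖y - z₀‖ ‖g‖ tends to 0. -/
theorem exists_isTrap (hU : IsOpen U) (hf : MeromorphicNFOn f U) (hz₀ : z₀ ∈ U)
    (hroot : f z₀ = 0) (hz : AnalyticAt ℂ f z₀)
    (hsimple : deriv f z₀ ≠ 0) (hf'' : deriv (deriv f) z₀ ≠ 0) :
    ∃ r C, IsTrap f U z₀ r C := by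
  have hmem := root_mem_secantDomain hz₀ hz hsimple
  obtain ⟨hD, hG⟩ := secantDomain_mem_nhds_and_continuousAt hU hf hroot hz hmem
  have hne := secantFactor_root_ne_zero hroot hz hsimple hf''
  have hlog : ContinuousAt (fun p => |Real.log ‖secantFactor f z₀ p‖|) (z₀, z₀) :=
    (hG.norm.log (norm_ne_zero_iff.2 hne)).abs
  have hsmall : ContinuousAt (fun p : ℂ × ℂ => ‖p.2 - z₀‖ * ‖secantFactor f z₀ p‖) (z₀, z₀) :=
    (continuousAt_snd.sub continuousAt_const).norm.mul hG.norm
  have h1 := hG.eventually_ne hne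
  have h2 := hlog.eventually_le_const (lt_add_one _)
  have h3 := hsmall.eventually_lt_const
    (show ‖((z₀, z₀) : ℂ × ℂ).2 - z₀‖ * ‖secantFactor f z₀ (z₀, z₀)‖ < 1 / 2 by simp)
  obtain ⟨r, hr, h⟩ := Metric.eventually_nhds_iff_ball.1
    ((Filter.eventually_mem_set.2 hD).and (h1.and (h2.and h3)))
  refine ⟨r, _, hr, fun p hp => (h p hp).1, fun p hp => (h p hp).2.1,
    fun p hp => (h p hp).2.2.1, fun p hp => ?_⟩
  have h4 : (secantMap f p).1 - z₀ = _ := secantFirst_sub_root hf hroot hz (h p hp).1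
  rw [h4, mul_assoc, norm_mul, norm_mul, mul_comm]
  exact mul_le_mul_of_nonneg_right (h p hp).2.2.2.le (norm_nonneg _)

variable {r C : ℝ}

theorem mem_ball_prod_iff {p : ℂ × ℂ} :
    p ∈ Metric.ball ((z₀, z₀) : ℂ × ℂ) r ↔ ‖p.1 - z₀‖ < r ∧ ‖p.2 - z₀‖ < r := by
  rw [Metric.mem_ball, Prod.dist_eq, max_lt_iff, dist_eq_norm, dist_eq_norm]

theorem IsTrap.map_mem (h : IsTrap f U z₀ r C) {p : ℂ × ℂ}
    (hp : p ∈ Metric.ball ((z₀, z₀) : ℂ × ℂ) r) :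
    secantMap f p ∈ Metric.ball ((z₀, z₀) : ℂ × ℂ) r := by
  have h1 := h.contract p hp
  rw [mem_ball_prod_iff] at hp ⊢
  refine ⟨?_, hp.1⟩
  have := norm_nonneg (p.1 - z₀)
  linarith [hp.1]

theorem IsTrap.iterate_mem (h : IsTrap f U z₀ r C) {p : ℂ × ℂ}
    (hp : p ∈ Metric.ball ((z₀, z₀) : ℂ × ℂ) r) (n : ℕ) :
    (secantMap f)^[n] p ∈ Metric.ball ((z₀, z₀) : ℂ × ℂ) r := by
  induction n with
  | zero => exact hp
  | succ n ih => rw [Function.iterate_succ_apply']; exact h.map_mem ih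

theorem IsTrap.mem_basin (h : IsTrap f U z₀ r C) {p : ℂ × ℂ}
    (hp : p ∈ Metric.ball ((z₀, z₀) : ℂ × ℂ) r) : p ∈ basin f U z₀ := by
  refine ⟨fun n => h.mem_domain _ (h.iterate_mem hp n), ?_⟩
  have hb : ∀ n, ‖((secantMap f)^[n] p).1 - z₀‖ ≤ (1 / 2) ^ n * ‖p.1 - z₀‖ := by
    intro n
    induction n with
    | zero => simp
    | succ n ih =>
      rw [Function.iterate_succ_apply', pow_succ']
      have := h.contract _ (h.iterate_mem hp n)
      linarith
  have h0 : Tendsto (fun n : ℕ => (1 / 2 : ℝ) ^ n * ‖p.1 - z₀‖) atTop (𝓝 0) := by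
    simpa using (tendsto_pow_atTop_nhds_zero_of_lt_one (by norm_num : (0 : ℝ) ≤ 1 / 2)
      (by norm_num)).mul_const ‖p.1 - z₀‖
  have h1 : Tendsto (fun n => ((secantMap f)^[n] p).1) atTop (𝓝 z₀) :=
    tendsto_iff_norm_sub_tendsto_zero.2 (squeeze_zero (fun _ => norm_nonneg _) hb h0)
  have h2 : Tendsto (fun n => ((secantMap f)^[n] p).2) atTop (𝓝 z₀) := by
    rw [← tendsto_add_atTop_iff_nat 1]
    refine h1.congr fun n => ?_
    rw [Function.iterate_succ_apply']
    rfl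
  exact h1.prodMk_nhds h2

theorem IsTrap.exists_iterate_mem (h : IsTrap f U z₀ r C) {p : ℂ × ℂ} (hp : p ∈ basin f U z₀) :
    ∃ N, (secantMap f)^[N] p ∈ Metric.ball ((z₀, z₀) : ℂ × ℂ) r :=
  (hp.2.eventually_mem (Metric.ball_mem_nhds _ h.pos)).exists

theorem continuousAt_iterate (hU : IsOpen U) (hf : MeromorphicNFOn f U)
    (hroot : f z₀ = 0) (hz : AnalyticAt ℂ f z₀) {p : ℂ × ℂ} {n : ℕ}
    (hp : ∀ k < n, (secantMap f)^[k] p ∈ secantDomain f U) :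
    ContinuousAt (secantMap f)^[n] p := by
  induction n with
  | zero => exact continuousAt_id
  | succ n ih =>
    rw [Function.iterate_succ']
    have hc := (continuousOn_secantMap hU hf hroot hz).continuousAt
      ((isOpen_secantDomain hU hf hroot hz).mem_nhds (hp n n.lt_succ_self))
    exact hc.comp (ih fun k hk => hp k (hk.trans n.lt_succ_self))

/-- A point whose orbit reaches the trap lies in the basin. -/
theorem IsTrap.mem_basin_of_iterate (h : IsTrap f U z₀ r C) {p : ℂ × ℂ} {N : ℕ}
    (h1 : ∀ k < N, (secantMap f)^[k] p ∈ secantDomain f U)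
    (h2 : (secantMap f)^[N] p ∈ Metric.ball ((z₀, z₀) : ℂ × ℂ) r) : p ∈ basin f U z₀ := by
  have hb := h.mem_basin h2
  refine ⟨fun n => ?_, ?_⟩
  · rcases lt_or_ge n N with hn | hn
    · exact h1 n hn
    · obtain ⟨k, rfl⟩ := Nat.exists_eq_add_of_le' hn
      rw [Function.iterate_add_apply]
      exact hb.1 k
  · rw [← tendsto_add_atTop_iff_nat N]
    exact hb.2.congr fun n => by rw [Function.iterate_add_apply]

/-- Membership is decided by finitely many iterates lying in the open domain, followed by one lying
in the trap. -/
theorem isOpen_basin (hU : IsOpen U) (hf : MeromorphicNFOn f U)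
    (hroot : f z₀ = 0) (hz : AnalyticAt ℂ f z₀) (h : IsTrap f U z₀ r C) :
    IsOpen (basin f U z₀) := by
  refine isOpen_iff_mem_nhds.2 fun p hp => ?_
  obtain ⟨N, hN⟩ := h.exists_iterate_mem hp
  have hc : ∀ k, ContinuousAt (secantMap f)^[k] p := fun k =>
    continuousAt_iterate hU hf hroot hz fun j _ => hp.1 j
  have h1 : ∀ᶠ q in 𝓝 p, ∀ k ∈ Finset.range N, (secantMap f)^[k] q ∈ secantDomain f U :=
    (Filter.eventually_all_finset _).2 fun k _ =>
      (hc k).eventually_mem ((isOpen_secantDomain hU hf hroot hz).mem_nhds (hp.1 k))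
  filter_upwards [h1, (hc N).eventually_mem (Metric.isOpen_ball.mem_nhds hN)] with q h2 h3
  exact h.mem_basin_of_iterate (fun k hk => h2 k (Finset.mem_range.2 hk)) h3

theorem continuous_basin_iterate (hU : IsOpen U) (hf : MeromorphicNFOn f U)
    (hroot : f z₀ = 0) (hz : AnalyticAt ℂ f z₀) (n : ℕ) :
    Continuous fun p : basin f U z₀ => (secantMap f)^[n] p.1 :=
  continuous_iff_continuousAt.2 fun p =>
    (continuousAt_iterate hU hf hroot hz fun j _ => p.2.1 j).comp continuousAt_subtype_val

theorem continuous_basin_factor (hU : IsOpen U) (hf : MeromorphicNFOn f U)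
    (hroot : f z₀ = 0) (hz : AnalyticAt ℂ f z₀) (n : ℕ) :
    Continuous fun p : basin f U z₀ => secantFactor f z₀ ((secantMap f)^[n] p.1) :=
  (continuousOn_secantFactor hU hf hroot hz).comp_continuous
    (continuous_basin_iterate hU hf hroot hz n) fun p => p.2.1 n

/-! ### The modulus as an infinite product -/

/-- The partial products of the Böttcher-type modulus. -/
noncomputable def partialModulus (f : ℂ → ℂ) (z₀ : ℂ) (n : ℕ) (p : ℂ × ℂ) : ℝ :=
  ∏ k ∈ Finset.range n, ‖secantFactor f z₀ ((secantMap f)^[k] p)‖ ^ goldenWeight k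

/-- The Böttcher-type modulus as an infinite product. -/
noncomputable def bottcherModulus (f : ℂ → ℂ) (z₀ : ℂ) (p : ℂ × ℂ) : ℝ :=
  limUnder atTop fun n => partialModulus f z₀ n p

/-- Logarithms are taken only from index N on, so the first N factors may vanish. -/
theorem tendsto_partialModulus {p : ℂ × ℂ} {N : ℕ}
    (h0 : ∀ k, secantFactor f z₀ ((secantMap f)^[k + N] p) ≠ 0)
    (hC : ∀ k, |Real.log ‖secantFactor f z₀ ((secantMap f)^[k + N] p)‖| ≤ C) :
    Tendsto (fun n => partialModulus f z₀ n p) atTop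
      (𝓝 (partialModulus f z₀ N p * Real.exp (∑' k, goldenWeight (k + N) *
        Real.log ‖secantFactor f z₀ ((secantMap f)^[k + N] p)‖))) := by
  have hs : Summable fun k => goldenWeight (k + N) *
      Real.log ‖secantFactor f z₀ ((secantMap f)^[k + N] p)‖ := by
    refine Summable.of_norm_bounded (((summable_nat_add_iff N).2 summable_goldenWeight).mul_right C)
      fun k => ?_
    rw [norm_mul, Real.norm_eq_abs, Real.norm_eq_abs, abs_of_pos (goldenWeight_pos _)]
    exact mul_le_mul_of_nonneg_left (hC k) (goldenWeight_pos _).le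
  rw [← tendsto_add_atTop_iff_nat N]
  refine (((Real.continuous_exp.tendsto _).comp hs.hasSum.tendsto_sum_nat).const_mul
    (partialModulus f z₀ N p)).congr fun n => ?_
  rw [Function.comp_apply, Real.exp_sum, partialModulus, partialModulus, add_comm n N,
    Finset.prod_range_add]
  congr 1
  refine Finset.prod_congr rfl fun k _ => ?_
  rw [add_comm N k, Real.rpow_def_of_pos (norm_pos_iff.2 (h0 k)), mul_comm]

theorem bottcherModulus_eq {p : ℂ × ℂ} {N : ℕ}
    (h0 : ∀ k, secantFactor f z₀ ((secantMap f)^[k + N] p) ≠ 0)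
    (hC : ∀ k, |Real.log ‖secantFactor f z₀ ((secantMap f)^[k + N] p)‖| ≤ C) :
    bottcherModulus f z₀ p = partialModulus f z₀ N p * Real.exp (∑' k, goldenWeight (k + N) *
        Real.log ‖secantFactor f z₀ ((secantMap f)^[k + N] p)‖) :=
  (tendsto_partialModulus h0 hC).limUnder_eq

theorem bottcherModulus_eq_zero {p : ℂ × ℂ} {k : ℕ}
    (h0 : secantFactor f z₀ ((secantMap f)^[k] p) = 0) : bottcherModulus f z₀ p = 0 := by
  refine Tendsto.limUnder_eq (tendsto_const_nhds.congr' ?_)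
  filter_upwards [eventually_gt_atTop k] with n hn
  refine (Finset.prod_eq_zero (Finset.mem_range.2 hn) ?_).symm
  rw [h0, norm_zero, Real.zero_rpow (goldenWeight_pos k).ne']

/-- Where the N-th iterate lies in the trap, the product is a finite continuous product times the
exponential of a series dominated by C times the summable weights. -/
theorem continuous_bottcherModulus (hU : IsOpen U) (hf : MeromorphicNFOn f U)
    (hroot : f z₀ = 0) (hz : AnalyticAt ℂ f z₀) (h : IsTrap f U z₀ r C) :
    Continuous fun p : basin f U z₀ => bottcherModulus f z₀ p.1 := by
  refine continuous_iff_continuousAt.2 fun p => ?_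
  obtain ⟨N, hN⟩ := h.exists_iterate_mem p.2
  set V : Set (basin f U z₀) :=
    {q | (secantMap f)^[N] q.1 ∈ Metric.ball ((z₀, z₀) : ℂ × ℂ) r} with hV
  have hVo : IsOpen V :=
    Metric.isOpen_ball.preimage (continuous_basin_iterate hU hf hroot hz N)
  have hVmem : ∀ q ∈ V, ∀ k,
      (secantMap f)^[k + N] q.1 ∈ Metric.ball ((z₀, z₀) : ℂ × ℂ) r := by
    intro q hq k
    rw [Function.iterate_add_apply]
    exact h.iterate_mem hq k
  have hcont : ContinuousOn (fun q : basin f U z₀ => partialModulus f z₀ N q.1 *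
      Real.exp (∑' k, goldenWeight (k + N) *
        Real.log ‖secantFactor f z₀ ((secantMap f)^[k + N] q.1)‖)) V := by
    refine ContinuousOn.mul ?_ (Real.continuous_exp.comp_continuousOn ?_)
    · refine Continuous.continuousOn ?_
      unfold partialModulus
      exact continuous_finsetProd _ fun k _ =>
        (continuous_basin_factor hU hf hroot hz k).norm.rpow_const fun _ =>
          Or.inr (goldenWeight_pos k).le
    · refine continuousOn_tsum (u := fun k => goldenWeight (k + N) * C) (fun k => ?_)
        (((summable_nat_add_iff N).2 summable_goldenWeight).mul_right C) fun k q hq => ?_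
      · refine continuousOn_const.mul (ContinuousOn.log
          (continuous_basin_factor hU hf hroot hz (k + N)).norm.continuousOn fun q hq => ?_)
        exact norm_ne_zero_iff.2 (h.factor_ne_zero _ (hVmem q hq k))
      · rw [norm_mul, Real.norm_eq_abs, Real.norm_eq_abs, abs_of_pos (goldenWeight_pos _)]
        exact mul_le_mul_of_nonneg_left (h.abs_log_le _ (hVmem q hq k)) (goldenWeight_pos _).le
  refine (hcont.continuousAt (hVo.mem_nhds hN)).congr ?_
  filter_upwards [hVo.mem_nhds hN] with q hq
  exact (bottcherModulus_eq (fun k => h.factor_ne_zero _ (hVmem q hq k))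
    fun k => h.abs_log_le _ (hVmem q hq k)).symm

/-! ### Growth of the errors along an orbit -/

/-- Each error divides the two that come two and three steps later, so zeros propagate; index j + 1
is skipped because error 1 is free when error 0 vanishes. -/
theorem secantError_eq_zero_of_le (hf : MeromorphicNFOn f U) (hroot : f z₀ = 0)
    (hz : AnalyticAt ℂ f z₀) {p : ℂ × ℂ} (hp : p ∈ basin f U z₀) {j : ℕ}
    (hj : secantError f z₀ p j = 0) {n : ℕ} (hn : j + 2 ≤ n) : secantError f z₀ p n = 0 := by
  induction n, hn using Nat.le_induction with
  | base => rw [secantError_add_two hf hroot hz (hp.1 j), hj]; simp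
  | succ n hn ih =>
    obtain ⟨m, rfl⟩ : ∃ m, n = m + 1 := ⟨n - 1, by omega⟩
    rw [secantError_add_two hf hroot hz (hp.1 m), ih]; simp

theorem tendsto_rpow_of_secantError_eq_zero (hf : MeromorphicNFOn f U) (hroot : f z₀ = 0)
    (hz : AnalyticAt ℂ f z₀) {p : ℂ × ℂ} (hp : p ∈ basin f U z₀) {j : ℕ}
    (hj : secantError f z₀ p j = 0) :
    Tendsto (fun n : ℕ => ‖((secantMap f)^[n] p).1 - z₀‖ ^ (1 / Real.goldenRatio ^ n : ℝ)) atTop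
      (𝓝 0) := by
  refine tendsto_const_nhds.congr' ?_
  filter_upwards [eventually_ge_atTop (j + 1)] with n hn
  rw [← secantError_succ, secantError_eq_zero_of_le hf hroot hz hp hj (by omega), norm_zero,
    Real.zero_rpow]
  have := Real.goldenRatio_pos
  positivity

/-- Along the orbit log ‖g‖ converges to its finite value at the root, and a convergent sequence is
bounded; a vanishing factor does no harm, as `Real.log 0 = 0`. -/
theorem exists_abs_log_factor_le (hU : IsOpen U) (hf : MeromorphicNFOn f U) (hz₀ : z₀ ∈ U)
    (hroot : f z₀ = 0) (hz : AnalyticAt ℂ f z₀)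
    (hsimple : deriv f z₀ ≠ 0) (hf'' : deriv (deriv f) z₀ ≠ 0)
    {p : ℂ × ℂ} (hp : p ∈ basin f U z₀) :
    ∃ C, ∀ k, |Real.log ‖secantFactor f z₀ ((secantMap f)^[k] p)‖| ≤ C := by
  have hG := (secantDomain_mem_nhds_and_continuousAt hU hf hroot hz
    (root_mem_secantDomain hz₀ hz hsimple)).2
  have hlog := hG.norm.log (norm_ne_zero_iff.2 (secantFactor_root_ne_zero hroot hz hsimple hf''))
  obtain ⟨C, hC⟩ := (Metric.isBounded_range_of_tendsto _
    (hlog.tendsto.comp hp.2)).exists_norm_le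
  exact ⟨C, fun k => hC _ ⟨k, rfl⟩⟩

theorem tendsto_rpow_bottcherModulus (hU : IsOpen U) (hf : MeromorphicNFOn f U) (hz₀ : z₀ ∈ U)
    (hroot : f z₀ = 0) (hz : AnalyticAt ℂ f z₀)
    (hsimple : deriv f z₀ ≠ 0) (hf'' : deriv (deriv f) z₀ ≠ 0)
    {p : ℂ × ℂ} (hp : p ∈ basin f U z₀) :
    Tendsto (fun n : ℕ => ‖((secantMap f)^[n] p).1 - z₀‖ ^ (1 / Real.goldenRatio ^ n : ℝ)) atTop
      (𝓝 (bottcherModulus f z₀ p * ‖p.1 - z₀‖ ^ (Real.goldenRatio / √5 : ℝ) *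
        ‖p.2 - z₀‖ ^ (1 / √5 : ℝ))) := by
  have hφ := Real.goldenRatio_pos
  have h5 : (0 : ℝ) < √5 := by positivity
  have e0 : secantError f z₀ p 0 = p.2 - z₀ := rfl
  have e1 : secantError f z₀ p 1 = p.1 - z₀ := rfl
  have hrec := fun n => secantError_add_two hf hroot hz (hp.1 n)
  -- If an initial error or some factor is zero, the claimed limit is 0 and the errors are
  -- eventually 0; otherwise logarithms apply throughout.
  by_cases hz0 : secantError f z₀ p 0 = 0
  · rw [← e0, hz0, norm_zero, Real.zero_rpow (by positivity), mul_zero]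
    exact tendsto_rpow_of_secantError_eq_zero hf hroot hz hp hz0
  by_cases hz1 : secantError f z₀ p 1 = 0
  · rw [← e1, hz1, norm_zero, Real.zero_rpow (by positivity), mul_zero, zero_mul]
    exact tendsto_rpow_of_secantError_eq_zero hf hroot hz hp hz1
  by_cases hG : ∃ k, secantFactor f z₀ ((secantMap f)^[k] p) = 0
  · obtain ⟨k, hk⟩ := hG
    rw [bottcherModulus_eq_zero hk, zero_mul, zero_mul]
    refine tendsto_rpow_of_secantError_eq_zero hf hroot hz hp (j := k + 2) ?_
    rw [hrec, hk, mul_zero]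
  push Not at hG
  have hne : ∀ n, secantError f z₀ p n ≠ 0 ∧ secantError f z₀ p (n + 1) ≠ 0 := by
    intro n
    induction n with
    | zero => exact ⟨hz0, hz1⟩
    | succ n ih =>
      refine ⟨ih.2, ?_⟩
      rw [hrec n]
      exact mul_ne_zero (mul_ne_zero ih.2 ih.1) (hG n)
  obtain ⟨C, hC⟩ := exists_abs_log_factor_le hU hf hz₀ hroot hz hsimple hf'' hp
  have hlim := tendsto_div_goldenRatio_pow (l := fun n => Real.log ‖secantError f z₀ p n‖) hC
    fun n => by
      rw [hrec n, norm_mul, norm_mul, Real.log_mul, Real.log_mul]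
      · exact norm_ne_zero_iff.2 (hne n).2
      · exact norm_ne_zero_iff.2 (hne n).1
      · exact mul_ne_zero (norm_ne_zero_iff.2 (hne n).2) (norm_ne_zero_iff.2 (hne n).1)
      · exact norm_ne_zero_iff.2 (hG n)
  have hval : bottcherModulus f z₀ p * ‖p.1 - z₀‖ ^ (Real.goldenRatio / √5 : ℝ) *
        ‖p.2 - z₀‖ ^ (1 / √5 : ℝ) = Real.exp (Real.goldenRatio / √5 *
          Real.log ‖secantError f z₀ p 1‖ + 1 / √5 * Real.log ‖secantError f z₀ p 0‖ +
          ∑' k, goldenWeight k * Real.log ‖secantFactor f z₀ ((secantMap f)^[k] p)‖) := by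
    rw [bottcherModulus_eq (N := 0) hG hC, ← e0, ← e1,
      Real.rpow_def_of_pos (norm_pos_iff.2 hz1), Real.rpow_def_of_pos (norm_pos_iff.2 hz0),
      Real.exp_add, Real.exp_add]
    simp only [partialModulus, Finset.range_zero, Finset.prod_empty, one_mul, add_zero]
    rw [mul_comm (Real.log _), mul_comm (Real.log _)]
    ring
  rw [hval]
  refine ((Real.continuous_exp.tendsto _).comp hlim).congr fun n => ?_
  rw [Function.comp_apply, ← secantError_succ,
    Real.rpow_def_of_pos (norm_pos_iff.2 (hne n).2), mul_one_div]

theorem bottcherModulus_nonneg (hU : IsOpen U) (hf : MeromorphicNFOn f U) (hz₀ : z₀ ∈ U)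
    (hroot : f z₀ = 0) (hz : AnalyticAt ℂ f z₀)
    (hsimple : deriv f z₀ ≠ 0) (hf'' : deriv (deriv f) z₀ ≠ 0)
    {p : ℂ × ℂ} (hp : p ∈ basin f U z₀) : 0 ≤ bottcherModulus f z₀ p := by
  by_cases hG : ∃ k, secantFactor f z₀ ((secantMap f)^[k] p) = 0
  · obtain ⟨k, hk⟩ := hG
    exact (bottcherModulus_eq_zero hk).ge
  push Not at hG
  obtain ⟨C, hC⟩ := exists_abs_log_factor_le hU hf hz₀ hroot hz hsimple hf'' hp
  rw [bottcherModulus_eq (N := 0) hG hC]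
  simp only [partialModulus, Finset.range_zero, Finset.prod_empty, one_mul]
  positivity

theorem exists_factor_eq_zero_of_bottcherModulus_eq_zero (hU : IsOpen U) (hf : MeromorphicNFOn f U)
    (hz₀ : z₀ ∈ U) (hroot : f z₀ = 0) (hz : AnalyticAt ℂ f z₀)
    (hsimple : deriv f z₀ ≠ 0) (hf'' : deriv (deriv f) z₀ ≠ 0)
    {p : ℂ × ℂ} (hp : p ∈ basin f U z₀) (h0 : bottcherModulus f z₀ p = 0) :
    ∃ k, secantFactor f z₀ ((secantMap f)^[k] p) = 0 := by
  by_contra! hG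
  obtain ⟨C, hC⟩ := exists_abs_log_factor_le hU hf hz₀ hroot hz hsimple hf'' hp
  rw [bottcherModulus_eq (N := 0) hG hC] at h0
  simp [partialModulus, (Real.exp_pos _).ne'] at h0

theorem analyticAt_of_deriv_ne_zero (hf : MeromorphicNFOn f U) (hz₀ : z₀ ∈ U)
    (hsimple : deriv f z₀ ≠ 0) : AnalyticAt ℂ f z₀ :=
  analyticAt_of_not_isPole (hf hz₀) (not_isPole_of_continuousAt (hf hz₀)
    (differentiableAt_of_deriv_ne_zero hsimple).continuousAt)

/-! ### Uniqueness of the modulus -/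

/-- The points of the basin with both coordinates different from `z₀` are dense in it. -/
theorem dense_basin_off_axes (hopen : IsOpen (basin f U z₀)) :
    Dense {p : basin f U z₀ | p.1.1 ≠ z₀ ∧ p.1.2 ≠ z₀} := by
  have h : Dense (({z₀}ᶜ : Set ℂ) ×ˢ ({z₀}ᶜ : Set ℂ)) :=
    (dense_compl_singleton z₀).prod (dense_compl_singleton z₀)
  exact h.preimage hopen.isOpenMap_subtype_val

theorem IsBottcherModulus.unique (hopen : IsOpen (basin f U z₀)) {H₁ H₂ : basin f U z₀ → ℝ}
    (h₁ : IsBottcherModulus f U z₀ H₁) (h₂ : IsBottcherModulus f U z₀ H₂) : H₁ = H₂ := by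
  refine h₁.1.ext_on (dense_basin_off_axes hopen) h₂.1 fun p hp => ?_
  have h := tendsto_nhds_unique (h₁.2 p) (h₂.2 p)
  have hx : ‖p.1.1 - z₀‖ ^ (Real.goldenRatio / √5 : ℝ) ≠ 0 :=
    (Real.rpow_pos_of_pos (norm_pos_iff.2 (sub_ne_zero.2 hp.1)) _).ne'
  have hy : ‖p.1.2 - z₀‖ ^ (1 / √5 : ℝ) ≠ 0 :=
    (Real.rpow_pos_of_pos (norm_pos_iff.2 (sub_ne_zero.2 hp.2)) _).ne'
  exact mul_right_cancel₀ hx (mul_right_cancel₀ hy h)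

/-! ### Functional equation and bounds -/

/-- The limit of `|π₁ (S_f^n p) - z₀| ^ (1 / φ ^ n)` expressed through a modulus `H`. -/
noncomputable def growthLimit (H : basin f U z₀ → ℝ) (p : basin f U z₀) : ℝ :=
  H p * ‖p.1.1 - z₀‖ ^ (Real.goldenRatio / √5 : ℝ) * ‖p.1.2 - z₀‖ ^ (1 / √5 : ℝ)

variable {H : basin f U z₀ → ℝ}

theorem growthLimit_nonneg (h0 : ∀ p, 0 ≤ H p) (p : basin f U z₀) : 0 ≤ growthLimit H p := by
  have := h0 p
  unfold growthLimit; positivity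

theorem IsBottcherModulus.continuous_growthLimit (h : IsBottcherModulus f U z₀ H) :
    Continuous (growthLimit H) := by
  have hφ := Real.goldenRatio_pos
  have h5 : (0 : ℝ) < √5 := by positivity
  have c1 : Continuous fun p : basin f U z₀ => ‖p.1.1 - z₀‖ := by fun_prop
  have c2 : Continuous fun p : basin f U z₀ => ‖p.1.2 - z₀‖ := by fun_prop
  exact (h.1.mul (c1.rpow_const fun _ => Or.inr (by positivity))).mul
    (c2.rpow_const fun _ => Or.inr (by positivity))

theorem iterate_basinMap (p : basin f U z₀) (n : ℕ) :
    ((basinMap f U z₀)^[n] p).1 = (secantMap f)^[n] p.1 := by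
  induction n with
  | zero => rfl
  | succ n ih => rw [Function.iterate_succ_apply', Function.iterate_succ_apply', ← ih]; rfl

/-- The sequence for the image is the shifted sequence raised to the power φ, because 1/φⁿ = φ ·
1/φⁿ⁺¹. -/
theorem IsBottcherModulus.growthLimit_basinMap (h : IsBottcherModulus f U z₀ H)
    (p : basin f U z₀) :
    growthLimit H (basinMap f U z₀ p) = growthLimit H p ^ Real.goldenRatio := by
  have hφ := Real.goldenRatio_pos
  have h1 := h.2 (basinMap f U z₀ p)
  have h2 := ((h.2 p).comp (tendsto_add_atTop_nat 1)).rpow_const (p := Real.goldenRatio)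
    (Or.inr hφ.le)
  refine tendsto_nhds_unique h1 (h2.congr fun n => ?_)
  rw [Function.comp_apply, ← Real.rpow_mul (norm_nonneg _), Function.iterate_succ_apply, pow_succ]
  congr 1
  field_simp

theorem IsBottcherModulus.growthLimit_iterate (h : IsBottcherModulus f U z₀ H)
    (h0 : ∀ p, 0 ≤ H p) (p : basin f U z₀) (n : ℕ) :
    growthLimit H ((basinMap f U z₀)^[n] p) = growthLimit H p ^ (Real.goldenRatio ^ n) := by
  induction n with
  | zero => simp
  | succ n ih =>
    rw [Function.iterate_succ_apply', h.growthLimit_basinMap, ih,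
      ← Real.rpow_mul (growthLimit_nonneg h0 p), pow_succ]

/-- A value at least 1 would stay at least 1 under the powers φⁿ, whereas along the orbit the limit
function tends to its value 0 at the root. -/
theorem IsBottcherModulus.growthLimit_lt_one (h : IsBottcherModulus f U z₀ H)
    (h0 : ∀ p, 0 ≤ H p) (hroot : (z₀, z₀) ∈ basin f U z₀) (p : basin f U z₀) :
    growthLimit H p < 1 := by
  have hφ := Real.goldenRatio_pos
  have ht : Tendsto (fun n => (basinMap f U z₀)^[n] p) atTop (𝓝 ⟨(z₀, z₀), hroot⟩) :=
    tendsto_subtype_rng.2 (p.2.2.congr fun n => (iterate_basinMap p n).symm)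
  have hl := (h.continuous_growthLimit.tendsto _).comp ht
  have hv : growthLimit H ⟨(z₀, z₀), hroot⟩ = 0 := by
    have h5 : (0 : ℝ) < √5 := by positivity
    rw [growthLimit, sub_self, norm_zero, Real.zero_rpow (by positivity), mul_zero, zero_mul]
  rw [hv] at hl
  obtain ⟨n, hn⟩ := (hl.eventually_lt_const one_pos).exists
  by_contra! hge
  rw [Function.comp_apply, h.growthLimit_iterate h0] at hn
  exact absurd hn (not_lt.2 (Real.one_le_rpow hge (by positivity)))

theorem growthLimit_rpow_inv (h0 : ∀ p, 0 ≤ H p) (p : basin f U z₀) :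
    H p ^ (1 / Real.goldenRatio : ℝ) * ‖p.1.1 - z₀‖ ^ (1 / √5 : ℝ) *
      ‖p.1.2 - z₀‖ ^ (Real.goldenRatio⁻¹ / √5 : ℝ) =
      growthLimit H p ^ (1 / Real.goldenRatio : ℝ) := by
  have hφ := Real.goldenRatio_pos
  have h1 := h0 p
  rw [growthLimit, Real.mul_rpow (by positivity) (by positivity),
    Real.mul_rpow h1 (by positivity), ← Real.rpow_mul (norm_nonneg _),
    ← Real.rpow_mul (norm_nonneg _)]
  congr 3
  · field_simp
  · field_simp

theorem potential_eq_max (h0 : ∀ p, 0 ≤ H p) (p : basin f U z₀) :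
    potential f U z₀ H p =
      max (growthLimit H p) (growthLimit H p ^ (1 / Real.goldenRatio : ℝ)) := by
  rw [← growthLimit_rpow_inv h0]
  rfl

/-- For 0 ≤ L ≤ 1 the exponent 1/φ < 1 can only increase L, so the second entry of the maximum wins.
-/
theorem IsBottcherModulus.potential_eq (h : IsBottcherModulus f U z₀ H)
    (h0 : ∀ p, 0 ≤ H p) (hroot : (z₀, z₀) ∈ basin f U z₀) (p : basin f U z₀) :
    potential f U z₀ H p = growthLimit H p ^ (1 / Real.goldenRatio : ℝ) := by
  have hφ := Real.goldenRatio_pos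
  rw [potential_eq_max h0, max_eq_right]
  refine Real.self_le_rpow_of_le_one (growthLimit_nonneg h0 p)
    (h.growthLimit_lt_one h0 hroot p).le ?_
  rw [div_le_one hφ]
  exact Real.one_lt_goldenRatio.le

/-! ### Independence of the norm -/

/-- A norm on `ℂ × ℂ` is comparable with the maximum norm. -/
theorem exists_seminorm_bounds (N : Seminorm ℂ (ℂ × ℂ)) (hN : ∀ v, N v = 0 → v = 0) :
    ∃ c C : ℝ, 0 < c ∧ 0 < C ∧ ∀ v, c * ‖v‖ ≤ N v ∧ N v ≤ C * ‖v‖ := by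
  have hup : ∀ v, N v ≤ (N (1, 0) + N (0, 1) + 1) * ‖v‖ := by
    intro v
    have hv : v = v.1 • ((1, 0) : ℂ × ℂ) + v.2 • ((0, 1) : ℂ × ℂ) := by ext <;> simp
    have h1 : N v ≤ ‖v.1‖ * N (1, 0) + ‖v.2‖ * N (0, 1) := by
      conv_lhs => rw [hv]
      refine (map_add_le_add N _ _).trans ?_
      rw [map_smul_eq_mul, map_smul_eq_mul]
    have h2 := mul_le_mul_of_nonneg_right (norm_fst_le v) (apply_nonneg N (1, 0))
    have h3 := mul_le_mul_of_nonneg_right (norm_snd_le v) (apply_nonneg N (0, 1))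
    have h4 := norm_nonneg v
    linarith
  have hC : 0 < N (1, 0) + N (0, 1) + 1 := by
    have := apply_nonneg N (1, 0)
    have := apply_nonneg N (0, 1)
    linarith
  have hcont : Continuous N := by
    refine (LipschitzWith.of_dist_le_mul (K := (N (1, 0) + N (0, 1) + 1).toNNReal)
      fun v w => ?_).continuous
    rw [Real.coe_toNNReal _ hC.le, dist_eq_norm, dist_eq_norm, Real.norm_eq_abs]
    exact (abs_sub_map_le_sub N v w).trans (hup _)
  -- The lower constant is the minimum of N on the compact unit sphere.
  obtain ⟨u, hu, hmin⟩ := (isCompact_sphere (0 : ℂ × ℂ) 1).exists_isMinOn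
    (NormedSpace.sphere_nonempty.2 zero_le_one) hcont.continuousOn
  have hu1 : ‖u‖ = 1 := by simpa using hu
  have hupos : 0 < N u := by
    refine lt_of_le_of_ne (apply_nonneg N u) fun h => ?_
    rw [hN u h.symm, norm_zero] at hu1
    exact zero_ne_one hu1
  refine ⟨N u, _, hupos, hC, fun v => ⟨?_, hup v⟩⟩
  rcases eq_or_ne v 0 with rfl | hv
  · simp
  have hv' : 0 < ‖v‖ := norm_pos_iff.2 hv
  have hmem : ((‖v‖⁻¹ : ℝ) : ℂ) • v ∈ Metric.sphere (0 : ℂ × ℂ) 1 := by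
    simp [norm_smul, hv'.ne']
  have h1 : N u ≤ N (((‖v‖⁻¹ : ℝ) : ℂ) • v) := hmin hmem
  rw [map_smul_eq_mul, Complex.norm_real, norm_inv, norm_norm, ← div_eq_inv_mul,
    le_div_iff₀ hv'] at h1
  exact h1

theorem tendsto_const_rpow_inv_goldenRatio_pow {c : ℝ} (hc : 0 < c) :
    Tendsto (fun n : ℕ => c ^ (1 / Real.goldenRatio ^ n : ℝ)) atTop (𝓝 1) := by
  have h1 : Tendsto (fun n : ℕ => (1 / Real.goldenRatio ^ n : ℝ)) atTop (𝓝 0) := by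
    have := tendsto_pow_atTop_nhds_zero_of_lt_one (inv_nonneg.2 Real.goldenRatio_pos.le)
        (inv_lt_one_of_one_lt₀ Real.one_lt_goldenRatio)
    exact this.congr fun n => by rw [inv_pow, one_div]
  have h2 := ((Real.continuous_const_rpow hc.ne').tendsto 0).comp h1
  rwa [Real.rpow_zero] at h2

/-- At time n + 1 the maximum norm compares two consecutive first coordinates; the older one carries
the exponent 1/φⁿ⁺¹ and so contributes the 1/φ power of the limit. -/
theorem IsBottcherModulus.tendsto_norm (h : IsBottcherModulus f U z₀ H)
    (h0 : ∀ p, 0 ≤ H p) (p : basin f U z₀) :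
    Tendsto (fun n : ℕ => ‖(secantMap f)^[n] p.1 - (z₀, z₀)‖ ^ (1 / Real.goldenRatio ^ n : ℝ))
      atTop (𝓝 (potential f U z₀ H p)) := by
  have hφ := Real.goldenRatio_pos
  rw [potential_eq_max h0, ← tendsto_add_atTop_iff_nat 1]
  have h1 := h.2 p
  refine ((h1.comp (tendsto_add_atTop_nat 1)).max
    (h1.rpow_const (p := 1 / Real.goldenRatio) (Or.inr (by positivity)))).congr fun n => ?_
  have h2 : ((secantMap f)^[n + 1] p.1).2 = ((secantMap f)^[n] p.1).1 := by
    rw [Function.iterate_succ_apply']; rfl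
  have hmono : MonotoneOn (fun x : ℝ => x ^ (1 / Real.goldenRatio ^ (n + 1) : ℝ)) (Set.Ici 0) :=
    fun x hx y _ hxy => Real.rpow_le_rpow hx hxy (by positivity)
  rw [Prod.norm_def, Prod.fst_sub, Prod.snd_sub, h2,
    hmono.map_max (norm_nonneg _) (norm_nonneg _), Function.comp_apply,
    ← Real.rpow_mul (norm_nonneg _)]
  congr 2
  rw [pow_succ]
  field_simp

/-- Comparison constants disappear in the limit, since their 1/φⁿ powers tend to 1. -/
theorem IsBottcherModulus.tendsto_seminorm (h : IsBottcherModulus f U z₀ H)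
    (h0 : ∀ p, 0 ≤ H p) (N : Seminorm ℂ (ℂ × ℂ)) (hN : ∀ v, N v = 0 → v = 0)
    (p : basin f U z₀) :
    Tendsto (fun n : ℕ => N ((secantMap f)^[n] p.1 - (z₀, z₀)) ^ (1 / Real.goldenRatio ^ n : ℝ))
      atTop (𝓝 (potential f U z₀ H p)) := by
  have hφ := Real.goldenRatio_pos
  obtain ⟨c, C, hc, hC, hb⟩ := exists_seminorm_bounds N hN
  have ht := h.tendsto_norm h0 p
  have h1 := (tendsto_const_rpow_inv_goldenRatio_pow hc).mul ht
  have h2 := (tendsto_const_rpow_inv_goldenRatio_pow hC).mul ht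
  rw [one_mul] at h1 h2
  refine tendsto_of_tendsto_of_tendsto_of_le_of_le h1 h2 (fun n => ?_) fun n => ?_
  · dsimp only
    rw [← Real.mul_rpow hc.le (norm_nonneg _)]
    exact Real.rpow_le_rpow (by positivity) (hb _).1 (by positivity)
  · dsimp only
    rw [← Real.mul_rpow hC.le (norm_nonneg _)]
    exact Real.rpow_le_rpow (apply_nonneg N _) (hb _).2 (by positivity)

/-! ### Existence, zero set and conclusion -/

theorem isBottcherModulus_bottcherModulus (hU : IsOpen U) (hf : MeromorphicNFOn f U)
    (hz₀ : z₀ ∈ U) (hroot : f z₀ = 0) (hsimple : deriv f z₀ ≠ 0)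
    (hf'' : deriv (deriv f) z₀ ≠ 0) :
    IsBottcherModulus f U z₀ fun p => bottcherModulus f z₀ p.1 := by
  have hz := analyticAt_of_deriv_ne_zero hf hz₀ hsimple
  obtain ⟨r, C, h⟩ := exists_isTrap hU hf hz₀ hroot hz hsimple hf''
  exact ⟨continuous_bottcherModulus hU hf hroot hz h, fun p =>
    tendsto_rpow_bottcherModulus hU hf hz₀ hroot hz hsimple hf'' p.2⟩

/-- The orbit reaches `(z₀, z₀)` as soon as one error vanishes. -/
theorem exists_iterate_eq_root (hf : MeromorphicNFOn f U) (hroot : f z₀ = 0)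
    (hz : AnalyticAt ℂ f z₀) {p : ℂ × ℂ} (hp : p ∈ basin f U z₀) {j : ℕ}
    (hj : secantError f z₀ p j = 0) : (secantMap f)^[j + 2] p = (z₀, z₀) := by
  have h1 := secantError_eq_zero_of_le hf hroot hz hp hj (n := j + 2) le_rfl
  have h2 := secantError_eq_zero_of_le hf hroot hz hp hj (n := j + 3) (by omega)
  rw [secantError_succ] at h2
  exact Prod.ext (sub_eq_zero.1 h2) (sub_eq_zero.1 h1)

/-- A zero of the limit function comes from a vanishing initial error or factor, hence from a
vanishing error, after which the orbit lands on the root. Conversely, an orbit that hits the root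
has entered the trap, so it starts in the basin. -/
theorem image_zero_potential (hU : IsOpen U) (hf : MeromorphicNFOn f U)
    (hz₀ : z₀ ∈ U) (hroot : f z₀ = 0) (hsimple : deriv f z₀ ≠ 0)
    (hf'' : deriv (deriv f) z₀ ≠ 0) :
    Subtype.val '' {p : basin f U z₀ |
      potential f U z₀ (fun p => bottcherModulus f z₀ p.1) p = 0} =
      iteratedPreimages f U z₀ := by
  have hφ := Real.goldenRatio_pos
  have hz := analyticAt_of_deriv_ne_zero hf hz₀ hsimple
  obtain ⟨r, C, htrap⟩ := exists_isTrap hU hf hz₀ hroot hz hsimple hf''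
  have hH := isBottcherModulus_bottcherModulus hU hf hz₀ hroot hsimple hf''
  have h0 : ∀ p : basin f U z₀, 0 ≤ bottcherModulus f z₀ p.1 := fun p =>
    bottcherModulus_nonneg hU hf hz₀ hroot hz hsimple hf'' p.2
  have hmem : (z₀, z₀) ∈ basin f U z₀ := htrap.mem_basin (Metric.mem_ball_self htrap.pos)
  have hpot : ∀ p : basin f U z₀, potential f U z₀ (fun p => bottcherModulus f z₀ p.1) p = 0 ↔
      growthLimit (fun p : basin f U z₀ => bottcherModulus f z₀ p.1) p = 0 := fun p => by
    rw [hH.potential_eq h0 hmem, Real.rpow_eq_zero (growthLimit_nonneg h0 p) (by positivity)]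
  ext p
  simp only [Set.mem_image, Set.mem_ofPred_eq, iteratedPreimages, Set.mem_iUnion]
  constructor
  · rintro ⟨p, hp, rfl⟩
    rw [hpot, growthLimit, mul_eq_zero, mul_eq_zero] at hp
    have hj : ∃ j, secantError f z₀ p.1 j = 0 := by
      rcases hp with (hp | hp) | hp
      · obtain ⟨k, hk⟩ := exists_factor_eq_zero_of_bottcherModulus_eq_zero hU hf hz₀ hroot hz
          hsimple hf'' p.2 hp
        exact ⟨k + 2, by rw [secantError_add_two hf hroot hz (p.2.1 k), hk, mul_zero]⟩
      · rw [Real.rpow_eq_zero (norm_nonneg _) (by positivity), norm_eq_zero] at hp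
        exact ⟨1, hp⟩
      · rw [Real.rpow_eq_zero (norm_nonneg _) (by positivity), norm_eq_zero] at hp
        exact ⟨0, hp⟩
    obtain ⟨j, hj⟩ := hj
    exact ⟨j + 2, fun k _ => p.2.1 k, exists_iterate_eq_root hf hroot hz p.2 hj⟩
  · rintro ⟨n, h1, h2⟩
    have hp : p ∈ basin f U z₀ := htrap.mem_basin_of_iterate h1 (by
      rw [h2]; exact Metric.mem_ball_self htrap.pos)
    refine ⟨⟨p, hp⟩, ?_, rfl⟩
    rw [hpot]
    have hj : secantError f z₀ p (n + 1) = 0 := by rw [secantError_succ, h2, sub_self]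
    exact tendsto_nhds_unique (hH.2 ⟨p, hp⟩)
      (tendsto_rpow_of_secantError_eq_zero hf hroot hz hp hj)

end SecantMethod

theorem corollary3p2 (U : Set ℂ) (hUo : IsOpen U) (hUc : IsConnected U)
    (f : ℂ → ℂ) (hf : MeromorphicNFOn f U)
    (z₀ : ℂ) (hz₀ : z₀ ∈ U) (hroot : f z₀ = 0) (hsimple : deriv f z₀ ≠ 0)
    (hf'' : deriv (deriv f) z₀ ≠ 0) :
    (∃! H : SecantMethod.basin f U z₀ → ℝ, SecantMethod.IsBottcherModulus f U z₀ H) ∧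
    ∀ H : SecantMethod.basin f U z₀ → ℝ, SecantMethod.IsBottcherModulus f U z₀ H →
      Continuous (SecantMethod.potential f U z₀ H) ∧
      (∀ p : SecantMethod.basin f U z₀,
        SecantMethod.potential f U z₀ H (SecantMethod.basinMap f U z₀ p) =
          SecantMethod.potential f U z₀ H p ^ Real.goldenRatio) ∧
      (∀ N : Seminorm ℂ (ℂ × ℂ), (∀ v, N v = 0 → v = 0) →
        ∀ p : SecantMethod.basin f U z₀,
          Tendsto
            (fun n : ℕ => N ((SecantMethod.secantMap f)^[n] p.1 - (z₀, z₀)) ^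
              (1 / Real.goldenRatio ^ n : ℝ))
            atTop (𝓝 (SecantMethod.potential f U z₀ H p))) ∧
      (Subtype.val '' {p : SecantMethod.basin f U z₀ | SecantMethod.potential f U z₀ H p = 0} =
        SecantMethod.iteratedPreimages f U z₀) ∧
      (∀ p : SecantMethod.basin f U z₀,
        0 ≤ SecantMethod.potential f U z₀ H p ∧ SecantMethod.potential f U z₀ H p < 1 ∧
        SecantMethod.potential f U z₀ H p =
          H p ^ (1 / Real.goldenRatio : ℝ) * ‖p.1.1 - z₀‖ ^ (1 / √5 : ℝ) *
            ‖p.1.2 - z₀‖ ^ (Real.goldenRatio⁻¹ / √5 : ℝ)) := by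
  have hz := SecantMethod.analyticAt_of_deriv_ne_zero hf hz₀ hsimple
  obtain ⟨r, C, htrap⟩ := SecantMethod.exists_isTrap hUo hf hz₀ hroot hz hsimple hf''
  have hopen := SecantMethod.isOpen_basin hUo hf hroot hz htrap
  have hmem : (z₀, z₀) ∈ SecantMethod.basin f U z₀ :=
    htrap.mem_basin (Metric.mem_ball_self htrap.pos)
  have hex := SecantMethod.isBottcherModulus_bottcherModulus hUo hf hz₀ hroot hsimple hf''
  refine ⟨⟨_, hex, fun H hH => hH.unique hopen hex⟩, fun H hH => ?_⟩
  -- Nonnegativity is not part of the characterization of the modulus; uniqueness transfers it from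
  -- the product.
  obtain rfl := hH.unique hopen hex
  have h0 : ∀ p : SecantMethod.basin f U z₀, 0 ≤ SecantMethod.bottcherModulus f z₀ p.1 :=
    fun p => SecantMethod.bottcherModulus_nonneg hUo hf hz₀ hroot hz hsimple hf'' p.2
  have hφ := Real.goldenRatio_pos
  have hpot := hH.potential_eq h0 hmem
  refine ⟨?_, fun p => ?_, fun N hN p => hH.tendsto_seminorm h0 N hN p,
    SecantMethod.image_zero_potential hUo hf hz₀ hroot hsimple hf'', fun p => ⟨?_, ?_, ?_⟩⟩
  · exact (hH.continuous_growthLimit.rpow_const fun _ => Or.inr (by positivity)).congr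
      fun p => (hpot p).symm
  · have hL := SecantMethod.growthLimit_nonneg h0 p
    rw [hpot, hpot, hH.growthLimit_basinMap, ← Real.rpow_mul hL, ← Real.rpow_mul hL, mul_comm]
  · rw [hpot]
    exact Real.rpow_nonneg (SecantMethod.growthLimit_nonneg h0 p) _
  · rw [hpot]
    exact Real.rpow_lt_one (SecantMethod.growthLimit_nonneg h0 p)
      (hH.growthLimit_lt_one h0 hmem p) (by positivity)
  · rw [hpot, SecantMethod.growthLimit_rpow_inv h0]
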